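/- Let $\sigma_x,\sigma_z$ be Pauli matrices and let $V:\mathbb C^2\to(\mathbb C^2)^{\otimes b}$ be an isometry (the encoder), with noiseless concatenations $V_0=I$, $V_{T+1}=V^{\otimes b^T}V_T$. Let $L_x$ and $L_z$ be operators that are, up to a global phase in $\{\pm1,\pm i\}$, tensor products of $I,\sigma_x,\sigma_z$ over the $b$ qubits (no $\sigma_y$ on any qubit), such that $L_wV=V\sigma_w$ for $w\in\{x,z\}$. For $v,w\in\{x,z\}$ let $n(v\to w)$ be the number of qubits on which $L_v$ acts as $\sigma_w$, let $\mathrm{weight}(L)$ be the number of qubits on which $L$ acts non-trivially, and put $$D_{xz}=\begin{pmatrix} n(x\to x)& n(z\to x)\\ n(x\to z)& n(z\to z)\end{pmatrix},\qquad b_{\max}=\max\{\mathrm{weight}(L_x),\mathrm{weight}(L_z)\},\qquad g_{xz}(T)=\max_{w\in\{x,z\}}(1,1)\,D_{xz}^T\,e_w,$$ with $e_x=(1,0)^{\mathrm T}$, $e_z=(0,1)^{\mathrm T}$, and let $\lambda_{\max}(D_{xz})$ be the spectral radius of $D_{xz}$. Let $p\in[0,1]$, $\mathcal N_w(\rho)=(1-p)\rho+p\,\sigma_w\rho\,\sigma_w$,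 $\mathcal N=\mathcal N_x\circ\mathcal N_z$, $\mathcal V(\rho)=V\rho V^\dagger$, and let $\mathcal E_T=\prod_{j=0}^{T-1}\mathcal N^{\otimes b^{j+1}}\circ\mathcal V^{\otimes b^j}$ (factors with larger $j$ applied later) be the channel of the noisy $b$-ary tree of depth $T$. Then: 1. For every $T\ge 0$ and every single-qubit density operator $\rho$, $\;\|\mathcal E_T(\rho)-\mathcal E_T(I/2)\|_1\le 2\sqrt2\,\sqrt{g_{xz}(T)}\,|1-2p|^T.$ 2. $g_{xz}(T)\le b_{\max}^T$ for every $T\ge0$. 3. For $w\in\{x,z\}$ let $L_w[0]=\sigma_w$ and let $L_w[t+1]$ be obtained from $L_w[t]$ by replacing each tensor factor $\sigma_v$ with $L_v$ and each factor $I$ with $I^{\otimes b}$. Then $L_w[T]\,V_T=V_T\,\sigma_w$ and $\mathrm{weight}(L_w[T])\le g_{xz}(T)$ for every $T\ge 0$. 4. If $(1-2p)^2\min\{\lambda_{\max}(D_{xz}),b_{\max}\}<1$, then in the limit $T\to\infty$ the output of $\mathcal E_T$ becomes independent of the input: $\|\mathcal E_T(\rho)-\mathcal E_T(\rho')\|_1\to0$,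 uniformly over single-qubit density operators $\rho,\rho'$. 5. (Anti-standard encoders.) If $L_x$ contains no $\sigma_x$ and $L_z$ contains no $\sigma_z$, then with $d_x=\mathrm{weight}(L_x)$ and $d_z=\mathrm{weight}(L_z)$ one has $\lambda_{\max}(D_{xz})=\sqrt{d_xd_z}$ and $g_{xz}(T)=\max\{d_x^{\lceil T/2\rceil}d_z^{\lfloor T/2\rfloor},\,d_z^{\lceil T/2\rceil}d_x^{\lfloor T/2\rfloor}\}$ for every $T\ge0$, and the conclusion of 4 holds whenever $(1-2p)^2\sqrt{d_xd_z}<1$. -/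

import Mathlib

open Matrix

noncomputable section

open scoped ComplexOrder

namespace QuantumTree

/-- Operators (in particular density operators) on a single qubit. -/
abbrev QubitOp := Matrix (Fin 2) (Fin 2) ℂ

/-- The Pauli matrix `σ_x`. -/
def pauliX : QubitOp := !![0, 1; 1, 0]

/-- The Pauli matrix `σ_z`. -/
def pauliZ : QubitOp := !![1, 0; 0, -1]

/-- Operators on a register of qubits that are labelled by `ι`; the computational basis is
indexed by the bit strings `ι → Fin 2`. -/
abbrev RegOp (ι : Type) := Matrix (ι → Fin 2) (ι → Fin 2) ℂ

/-- Density operators: positive semidefinite with unit trace. -/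
def IsDensity {n : Type} [Fintype n] (ρ : Matrix n n ℂ) : Prop :=
  ρ.PosSemidef ∧ ρ.trace = 1

/-- The trace norm `‖A‖₁ = tr √(A†A)`, i.e. the sum of the singular values of `A`. -/
def traceNorm {n : Type} [Fintype n] [DecidableEq n] (A : Matrix n n ℂ) : ℝ :=
  ∑ i, √((isHermitian_conjTranspose_mul_self A).eigenvalues i)

/-! ### Noise -/

/-- The single-qubit channel `ρ ↦ (1 - p) ρ + p P ρ P` (for a Pauli matrix `P`). -/
def flipChannel (P : QubitOp) (p : ℝ) : QubitOp →ₗ[ℂ] QubitOp :=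
  (1 - (p : ℂ)) • LinearMap.id + (p : ℂ) • (LinearMap.mulLeft ℂ P ∘ₗ LinearMap.mulRight ℂ P)

/-- Independent bit-flip and phase-flip errors, `𝒩 = 𝒩_x ∘ 𝒩_z`, with `p_x = p_z = p`. -/
def xzNoise (p : ℝ) : QubitOp →ₗ[ℂ] QubitOp :=
  flipChannel pauliX p ∘ₗ flipChannel pauliZ p

/-- The tensor power `𝒩^{⊗ι}` of a single-qubit map `𝒩`: the linear map that sends
`⊗ᵢ |xᵢ⟩⟨x'ᵢ|` to `⊗ᵢ 𝒩(|xᵢ⟩⟨x'ᵢ|)`. -/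
def tensorMap (ι : Type) [Fintype ι] [DecidableEq ι] (N : QubitOp →ₗ[ℂ] QubitOp)
    (ρ : RegOp ι) : RegOp ι :=
  Matrix.of fun y y' => ∑ x, ∑ x', (∏ i, N (Matrix.single (x i) (x' i) 1) (y i) (y' i)) * ρ x x'

/-! ### The tree -/

/-- The nodes at level `t` of the full `b`-ary tree, as paths from the root; there are `b ^ t`
of them. -/
abbrev Node (b t : ℕ) := Fin t → Fin b

/-- The `k`-th child of a node. -/
def child {b t : ℕ} (u : Node b t) (k : Fin b) : Node b (t + 1) :=
  Fin.snoc (α := fun _ => Fin b) u k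

/-- `V^{⊗ b^t}`, from the qubits at level `t` to the qubits at level `t + 1`: the qubit at each
node is encoded in the qubits at its children. -/
def encoderLayer {b : ℕ} (V : Matrix (Fin b → Fin 2) (Fin 2) ℂ) (t : ℕ) :
    Matrix (Node b (t + 1) → Fin 2) (Node b t → Fin 2) ℂ :=
  Matrix.of fun y x => ∏ u : Node b t, V (fun k => y (child u k)) (x u)

/-- The noiseless encoder `V_T = V^{⊗ b^{T-1}} ⋯ V^{⊗ b} V`, an isometry from the qubit at the
root (level `0` has a single node) to the `b ^ T` leaves. -/
def treeIsometry {b : ℕ} (V : Matrix (Fin b → Fin 2) (Fin 2) ℂ) :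
    (T : ℕ) → Matrix (Node b T → Fin 2) (Fin 2) ℂ
  | 0 => (1 : QubitOp).submatrix (fun y => y default) id
  | T + 1 => encoderLayer V T * treeIsometry V T

/-- The noisy tree channel `ℰ_T = ∏_{j<T} 𝒩^{⊗ b^{j+1}} ∘ 𝒱^{⊗ b^j}`, where
`𝒱(ρ) = V ρ V†`. There is no noise at the root. -/
def treeChannel {b : ℕ} (N : QubitOp →ₗ[ℂ] QubitOp) (V : Matrix (Fin b → Fin 2) (Fin 2) ℂ) :
    (T : ℕ) → QubitOp → RegOp (Node b T)
  | 0, ρ => ρ.submatrix (fun y => y default) (fun y => y default)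
  | T + 1, ρ => tensorMap (Node b (T + 1)) N
      (encoderLayer V T * treeChannel N V T ρ * (encoderLayer V T)ᴴ)

/-! ### Pauli operators without `σ_y` -/

/-- The single-qubit Pauli operators other than `σ_y`. -/
inductive Letter
  | I
  | X
  | Z
  deriving DecidableEq

/-- The matrix of a letter. -/
def Letter.toOp : Letter → QubitOp
  | .I => 1
  | .X => pauliX
  | .Z => pauliZ

/-- A tensor product, over the qubits labelled by `ι`, of operators `I`, `σ_x`, `σ_z`, up to a
global phase in `{1, -1, i, -i}`. -/
structure XZString (ι : Type) where
  /-- the global phase -/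
  phase : ℂ
  phase_pow : phase ^ 4 = 1
  /-- the operator that acts on each qubit -/
  letter : ι → Letter

namespace XZString

variable {ι : Type} [Fintype ι]

/-- The operator on the register. -/
def toOp (L : XZString ι) : RegOp ι :=
  L.phase • Matrix.of fun y x => ∏ i, (L.letter i).toOp (y i) (x i)

/-- The number of qubits on which the operator acts as `a`. -/
def count (L : XZString ι) (a : Letter) : ℕ :=
  (Finset.univ.filter fun i => L.letter i = a).card

/-- The number of qubits on which the operator acts non-trivially. -/
def weight (L : XZString ι) : ℕ :=
  (Finset.univ.filter fun i => L.letter i ≠ Letter.I).card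

end XZString

/-- `L` is a logical `σ` operator for `V`, i.e. `L V = V σ`. -/
def IsLogical {ι : Type} [Fintype ι] [DecidableEq ι] (V : Matrix (ι → Fin 2) (Fin 2) ℂ)
    (L : XZString ι) (σ : QubitOp) : Prop :=
  L.toOp * V = V * σ

section Concatenation

variable {b : ℕ} (Lx Lz : XZString (Fin b))

/-- The logical operator `L_a` that replaces the letter `a` (`L_I` is the identity). -/
def substitute : Letter → XZString (Fin b)
  | .I => ⟨1, one_pow 4, fun _ => Letter.I⟩
  | .X => Lx
  | .Z => Lz

/-- The concatenated logical operators: `L_w[0] = σ_w`, and `L_w[t+1]` is obtained from `L_w[t]`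
by replacing the operator `σ_a` on each qubit with `L_a` on the children of that qubit. -/
def concatLogical (w : Letter) : (t : ℕ) → XZString (Node b t)
  | 0 => ⟨1, one_pow 4, fun _ => w⟩
  | t + 1 =>
    { phase := (concatLogical w t).phase *
        ∏ u, (substitute Lx Lz ((concatLogical w t).letter u)).phase
      phase_pow := by
        rw [mul_pow, (concatLogical w t).phase_pow, one_mul, ← Finset.prod_pow]
        exact Finset.prod_eq_one fun u _ => XZString.phase_pow _
      letter := fun v =>
        (substitute Lx Lz ((concatLogical w t).letter (Fin.init v))).letter (v (Fin.last t)) }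

/-- The weight transition matrix, with rows and columns in the order `x`, `z`; the entry in
row `w` and column `v` is `n(v → w)`. -/
def weightMatrix : Matrix (Fin 2) (Fin 2) ℕ :=
  !![Lx.count .X, Lz.count .X; Lx.count .Z, Lz.count .Z]

/-- The spectral radius of the weight transition matrix. -/
def lambdaMax : ℝ :=
  (spectralRadius ℂ ((weightMatrix Lx Lz).map (Nat.cast : ℕ → ℂ))).toReal

/-- The maximum weight of the two logical operators. -/
def bMax : ℕ := max Lx.weight Lz.weight

/-- `g(T) = max_w (1,1) D^T e_w`. -/
def gxz (T : ℕ) : ℕ :=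
  max (![1, 1] ⬝ᵥ (weightMatrix Lx Lz ^ T *ᵥ ![1, 0]))
    (![1, 1] ⬝ᵥ (weightMatrix Lx Lz ^ T *ᵥ ![0, 1]))

end Concatenation

/-- The output of the tree becomes independent of the input as the depth grows: the trace
distance between the outputs for any two inputs tends to `0`, uniformly in the inputs. -/
def OutputBecomesIndependent {b : ℕ} (N : QubitOp →ₗ[ℂ] QubitOp)
    (V : Matrix (Fin b → Fin 2) (Fin 2) ℂ) : Prop :=
  ∀ ε : ℝ, 0 < ε → ∃ T₀ : ℕ, ∀ T, T₀ ≤ T → ∀ ρ ρ' : QubitOp, IsDensity ρ → IsDensity ρ' →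
    traceNorm (treeChannel N V T ρ - treeChannel N V T ρ') < ε

end QuantumTree

end

open QuantumTree

noncomputable section

open scoped ComplexOrder

/-!
A logical operator turns a Pauli error before an encoder into a Pauli error behind it. So all the
noise can be pushed to the leaves, and `E_T(ρ)` is a mixture of the images of `V_T ρ V_T†` under
random Pauli strings. For the input `σ_a ρ σ_a` the same states are mixed, with the law of the error
that results from an additional `σ_a` at the root. The trace distance of the two outputs is
therefore at most the `ℓ¹`-distance of two classical error laws, and hence at most `2√2` times
their Hellinger distance. The squared Hellinger distance contracts by `(1 - 2p)²` under the noise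
on one level and is subadditive over independent children, so that at depth `T` it is at most
`(1 - 2p)^{2T}` times the weight of `L_a[T]`, which is an entry of `(1, 1) D^T`. The state `I/2` is
reached from `ρ` by averaging over one flip by `σ_x` and one by `σ_z`. Gelfand's formula for
`D` turns the bound into the threshold.
-/

namespace QuantumTree

/-! ### The trace norm of Hermitian matrices -/

section TraceNorm

variable {m n ι : Type} [Fintype m] [Fintype n] [DecidableEq n] [Fintype ι]

theorem traceNorm_eq_sum_abs_eigenvalues {A : Matrix n n ℂ} (hA : A.IsHermitian) :
    traceNorm A = ∑ i, |hA.eigenvalues i| := by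
  have hcharpoly : (Aᴴ * A).charpoly =
      ∏ i, (Polynomial.X - Polynomial.C ((hA.eigenvalues i ^ 2 : ℝ) : ℂ)) := by
    rw [hA.eq, ← sq, ← cfc_pow_id (R := ℝ) A 2 hA.isSelfAdjoint, hA.charpoly_cfc_eq]
    rfl
  have hroots := (isHermitian_conjTranspose_mul_self A).roots_charpoly_eq_eigenvalues
  rw [hcharpoly, Polynomial.roots_prod _ _
    (Finset.prod_ne_zero_iff.2 fun i _ => Polynomial.X_sub_C_ne_zero _)] at hroots
  have hsum := congrArg (fun s : Multiset ℂ => (s.map fun z => √z.re).sum) hroots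
  simp only [Polynomial.roots_X_sub_C, Multiset.bind_singleton, Multiset.map_map] at hsum
  calc traceNorm A = ∑ i, √(hA.eigenvalues i ^ 2) := hsum.symm
    _ = ∑ i, |hA.eigenvalues i| := by simp only [Real.sqrt_sq_eq_abs]

theorem sum_norm_sq_apply_of_mem_unitaryGroup {U : Matrix n n ℂ} (hU : U ∈ unitaryGroup n ℂ)
    (k : n) : ∑ j, ‖U j k‖ ^ 2 = 1 := by
  have h := congrFun (congrFun (mem_unitaryGroup_iff'.1 hU) k) k
  simp only [mul_apply, star_apply, RCLike.star_def, Complex.conj_mul', one_apply_eq] at h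
  exact_mod_cast h

theorem sum_norm_diag_conj_le_traceNorm {A U : Matrix n n ℂ} (hA : A.IsHermitian)
    (hU : U ∈ unitaryGroup n ℂ) : ∑ j, ‖(Uᴴ * A * U) j j‖ ≤ traceNorm A := by
  set E : Matrix n n ℂ := hA.eigenvectorUnitary.1
  set W : Matrix n n ℂ := Uᴴ * E
  have hW : W ∈ unitaryGroup n ℂ := mul_mem (Unitary.star_mem hU) hA.eigenvectorUnitary.2
  have hdiag : Uᴴ * A * U = W * diagonal (RCLike.ofReal ∘ hA.eigenvalues) * Wᴴ := by
    conv_lhs => rw [hA.spectral_theorem, Unitary.conjStarAlgAut_apply]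
    simp only [W, conjTranspose_mul, conjTranspose_conjTranspose, Matrix.mul_assoc,
      star_eq_conjTranspose, E]
  have hentry : ∀ j, ‖(Uᴴ * A * U) j j‖ ≤ ∑ k, |hA.eigenvalues k| * ‖W j k‖ ^ 2 := fun j => by
    rw [hdiag, mul_apply]
    refine (norm_sum_le _ _).trans_eq (Finset.sum_congr rfl fun k _ => ?_)
    simp only [mul_diagonal, conjTranspose_apply, norm_mul, norm_star, Function.comp_apply,
      RCLike.norm_ofReal]
    ring
  calc ∑ j, ‖(Uᴴ * A * U) j j‖ ≤ ∑ j, ∑ k, |hA.eigenvalues k| * ‖W j k‖ ^ 2 :=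
        Finset.sum_le_sum fun j _ => hentry j
    _ = ∑ k, |hA.eigenvalues k| * ∑ j, ‖W j k‖ ^ 2 := by
        rw [Finset.sum_comm]
        simp only [Finset.mul_sum]
    _ = traceNorm A := by
        simp only [sum_norm_sq_apply_of_mem_unitaryGroup hW, mul_one,
          traceNorm_eq_sum_abs_eigenvalues hA]

theorem traceNorm_sum_smul_le (c : ι → ℝ) {A : ι → Matrix n n ℂ} (hA : ∀ i, (A i).IsHermitian) :
    traceNorm (∑ i, (c i : ℂ) • A i) ≤ ∑ i, |c i| * traceNorm (A i) := by
  -- Diagonalising the sum by a unitary `U` reduces the claim to the pinching inequality for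
  -- each `A i`.
  have hS : (∑ i, (c i : ℂ) • A i).IsHermitian := by
    simp [IsHermitian, conjTranspose_sum, (hA _).eq]
  set U : Matrix n n ℂ := hS.eigenvectorUnitary.1
  have heigenvalue (j : n) :
      (hS.eigenvalues j : ℂ) = ∑ i, (c i : ℂ) * (Uᴴ * A i * U) j j := by
    have h := congrFun (congrFun hS.conjStarAlgAut_star_eigenvectorUnitary j) j
    rw [Unitary.conjStarAlgAut_star_apply, diagonal_apply_eq] at h
    change (Uᴴ * (∑ i, (c i : ℂ) • A i) * U) j j = _ at h
    simpa [Matrix.mul_sum, Matrix.sum_mul, Matrix.sum_apply] using h.symm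
  rw [traceNorm_eq_sum_abs_eigenvalues hS]
  calc ∑ j, |hS.eigenvalues j| ≤ ∑ j, ∑ i, |c i| * ‖(Uᴴ * A i * U) j j‖ := by
        refine Finset.sum_le_sum fun j _ => ?_
        rw [← Real.norm_eq_abs, ← Complex.norm_real, heigenvalue]
        exact (norm_sum_le _ _).trans_eq (by simp)
    _ = ∑ i, |c i| * ∑ j, ‖(Uᴴ * A i * U) j j‖ := by
        rw [Finset.sum_comm]
        simp only [Finset.mul_sum]
    _ ≤ ∑ i, |c i| * traceNorm (A i) := by
        gcongr with i
        exact sum_norm_diag_conj_le_traceNorm (hA i) hS.eigenvectorUnitary.2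

theorem traceNorm_add_le {A B : Matrix n n ℂ} (hA : A.IsHermitian) (hB : B.IsHermitian) :
    traceNorm (A + B) ≤ traceNorm A + traceNorm B := by
  have h := traceNorm_sum_smul_le 1 (A := ![A, B]) (Fin.forall_fin_two.2 ⟨hA, hB⟩)
  simpa using h

theorem traceNorm_sub_comm (A B : Matrix n n ℂ) : traceNorm (A - B) = traceNorm (B - A) := by
  simp only [traceNorm, ← neg_sub B A, conjTranspose_neg, neg_mul_neg]

theorem traceNorm_sub_le {A B C : Matrix n n ℂ} (hA : A.IsHermitian) (hB : B.IsHermitian)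
    (hC : C.IsHermitian) : traceNorm (A - C) ≤ traceNorm (A - B) + traceNorm (B - C) := by
  simpa only [sub_add_sub_cancel] using traceNorm_add_le (hA.sub hB) (hB.sub hC)

theorem traceNorm_smul_le (c : ℝ) {A : Matrix n n ℂ} (hA : A.IsHermitian) :
    traceNorm ((c : ℂ) • A) ≤ |c| * traceNorm A := by
  simpa using traceNorm_sum_smul_le (fun _ : Unit => c) fun _ => hA

theorem IsDensity.traceNorm_eq_one {ρ : Matrix n n ℂ} (hρ : IsDensity ρ) : traceNorm ρ = 1 := by
  have h := hρ.1.isHermitian.trace_eq_sum_eigenvalues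
  rw [traceNorm_eq_sum_abs_eigenvalues hρ.1.isHermitian]
  simp only [abs_of_nonneg (hρ.1.eigenvalues_nonneg _)]
  simpa using congrArg Complex.re (h.symm.trans hρ.2)

theorem IsDensity.conj {ρ : Matrix n n ℂ} (hρ : IsDensity ρ) {A : Matrix m n ℂ}
    (hA : Aᴴ * A = 1) : IsDensity (A * ρ * Aᴴ) :=
  ⟨hρ.1.mul_mul_conjTranspose_same A, by
    rw [trace_mul_comm, ← Matrix.mul_assoc, hA, Matrix.one_mul, hρ.2]⟩

end TraceNorm

/-! ### Tensor products of families of matrices -/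

/-- The Kronecker product `⊗ᵢ Mᵢ` of a finite family of matrices. -/
def piKronecker {ι l m R : Type*} [Fintype ι] [CommSemiring R] (M : ι → Matrix l m R) :
    Matrix (ι → l) (ι → m) R :=
  of fun y x => ∏ i, M i (y i) (x i)

section PiKronecker

variable {ι l m n R : Type*} [Fintype ι] [CommSemiring R]

theorem piKronecker_mul [DecidableEq ι] [Fintype m] (M : ι → Matrix l m R) (N : ι → Matrix m n R) :
    piKronecker M * piKronecker N = piKronecker fun i => M i * N i := by
  ext y x
  simp only [piKronecker, mul_apply, of_apply, ← Finset.prod_mul_distrib]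
  rw [Finset.prod_univ_sum, Fintype.piFinset_univ]

theorem piKronecker_smul (c : ι → R) (M : ι → Matrix l m R) :
    piKronecker (fun i => c i • M i) = (∏ i, c i) • piKronecker M := by
  ext y x
  simp [piKronecker, Finset.prod_mul_distrib]

theorem piKronecker_conjTranspose [StarRing R] (M : ι → Matrix l m R) :
    (piKronecker M)ᴴ = piKronecker fun i => (M i)ᴴ := by
  ext y x
  simp [piKronecker, star_prod]

theorem piKronecker_one [DecidableEq m] :
    piKronecker (fun _ : ι => (1 : Matrix m m R)) = 1 := by
  ext y x
  simp only [piKronecker, of_apply, one_apply, funext_iff]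
  simp [Finset.prod_ite_zero]

theorem piKronecker_conjTranspose_mul_self [StarRing R] [DecidableEq ι] [Fintype l] [DecidableEq m]
    {M : ι → Matrix l m R} (hM : ∀ i, (M i)ᴴ * M i = 1) :
    (piKronecker M)ᴴ * piKronecker M = 1 := by
  simp only [piKronecker_conjTranspose, piKronecker_mul, hM, piKronecker_one]

end PiKronecker

/-! ### The layers of the tree -/

section Tree

variable {b t : ℕ} {V : Matrix (Fin b → Fin 2) (Fin 2) ℂ}

/-- A node below the root is a parent together with a birth rank. -/
def childEquiv (b t : ℕ) : Node b t × Fin b ≃ Node b (t + 1) where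
  toFun q := child q.1 q.2
  invFun v := (Fin.init v, v (Fin.last t))
  left_inv q := by simp [child]
  right_inv v := by simp [child]

/-- Groups the labels of level `t + 1` by parent. -/
def siblingEquiv (b t : ℕ) (α : Type*) : (Node b (t + 1) → α) ≃ (Node b t → Fin b → α) :=
  ((childEquiv b t).symm.arrowCongr (Equiv.refl α)).trans (Equiv.curry _ _ _)

@[to_additive]
theorem prod_node_succ {M : Type*} [CommMonoid M] (f : Node b (t + 1) → M) :
    ∏ v, f v = ∏ u : Node b t, ∏ k, f (child u k) := by
  rw [← (childEquiv b t).prod_comp, Fintype.prod_prod_type]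
  rfl

theorem encoderLayer_eq_submatrix (V : Matrix (Fin b → Fin 2) (Fin 2) ℂ) (t : ℕ) :
    encoderLayer V t = (piKronecker fun _ => V).submatrix (siblingEquiv b t (Fin 2)) id :=
  rfl

theorem piKronecker_node_succ (M : Node b (t + 1) → QubitOp) :
    piKronecker M = (piKronecker fun u => piKronecker fun k => M (child u k)).submatrix
      (siblingEquiv b t (Fin 2)) (siblingEquiv b t (Fin 2)) := by
  ext y x
  simp only [piKronecker, of_apply, prod_node_succ]
  rfl

theorem encoderLayer_mul_piKronecker {S : Node b t → QubitOp} {M : Node b (t + 1) → QubitOp}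
    {c : Node b t → ℂ} (h : ∀ u, V * S u = c u • (piKronecker (fun k => M (child u k)) * V)) :
    encoderLayer V t * piKronecker S = (∏ u, c u) • (piKronecker M * encoderLayer V t) := by
  have hparents : encoderLayer V t * piKronecker S =
      (piKronecker fun u => V * S u).submatrix (siblingEquiv b t (Fin 2)) id := by
    rw [← piKronecker_mul]
    rfl
  rw [hparents, piKronecker_node_succ M, encoderLayer_eq_submatrix, submatrix_mul_equiv,
    piKronecker_mul]
  simp only [h, piKronecker_smul]
  rfl

theorem encoderLayer_conjTranspose_mul_self (hV : Vᴴ * V = 1) (t : ℕ) :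
    (encoderLayer V t)ᴴ * encoderLayer V t = 1 := by
  rw [encoderLayer_eq_submatrix, conjTranspose_submatrix, submatrix_mul_equiv,
    piKronecker_conjTranspose_mul_self fun _ => hV, submatrix_id_id]

theorem treeIsometry_zero_mul (V : Matrix (Fin b → Fin 2) (Fin 2) ℂ) (A : QubitOp) :
    treeIsometry V 0 * A = A.submatrix (fun y => y default) id := by
  ext y x
  simp [treeIsometry, mul_apply, one_apply]

theorem piKronecker_mul_treeIsometry_zero (V : Matrix (Fin b → Fin 2) (Fin 2) ℂ) (A : QubitOp) :
    piKronecker (fun _ : Node b 0 => A) * treeIsometry V 0 = treeIsometry V 0 * A := by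
  have hA : piKronecker (fun _ : Node b 0 => A) = A.submatrix
      (Equiv.funUnique (Node b 0) (Fin 2)) (Equiv.funUnique (Node b 0) (Fin 2)) := by
    ext y x
    simp [piKronecker]
  rw [hA, treeIsometry_zero_mul]
  exact (submatrix_mul_equiv A 1 _ _ id).trans (by rw [Matrix.mul_one]; rfl)

theorem treeChannel_zero (N : QubitOp →ₗ[ℂ] QubitOp) (V : Matrix (Fin b → Fin 2) (Fin 2) ℂ)
    (ρ : QubitOp) : treeChannel N V 0 ρ = treeIsometry V 0 * ρ * (treeIsometry V 0)ᴴ := by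
  rw [treeIsometry_zero_mul]
  ext y y'
  simp [treeChannel, treeIsometry, mul_apply, one_apply]

theorem treeIsometry_conjTranspose_mul_self (hV : Vᴴ * V = 1) (T : ℕ) :
    (treeIsometry V T)ᴴ * treeIsometry V T = 1 := by
  induction T with
  | zero =>
    simpa [treeIsometry] using
      submatrix_mul_equiv (1 : QubitOp)ᴴ 1 id (Equiv.funUnique (Node b 0) (Fin 2)) id
  | succ T ih =>
    rw [treeIsometry, conjTranspose_mul, Matrix.mul_assoc, ← Matrix.mul_assoc (encoderLayer V T)ᴴ,
      encoderLayer_conjTranspose_mul_self hV, Matrix.one_mul, ih]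

end Tree

/-! ### Pauli errors -/

/-- Equality of matrices up to a global phase. -/
def PhaseEq {m n : Type*} (A B : Matrix m n ℂ) : Prop :=
  ∃ c : ℂ, ‖c‖ = 1 ∧ A = c • B

namespace PhaseEq

variable {l m n : Type*} {A B C : Matrix m n ℂ}

theorem refl (A : Matrix m n ℂ) : PhaseEq A A := ⟨1, norm_one, (one_smul ℂ A).symm⟩

theorem trans (hAB : PhaseEq A B) (hBC : PhaseEq B C) : PhaseEq A C := by
  obtain ⟨c, hc, rfl⟩ := hAB
  obtain ⟨d, hd, rfl⟩ := hBC
  exact ⟨c * d, by rw [norm_mul, hc, hd, one_mul], smul_smul c d C⟩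

theorem mul_left [Fintype m] (h : PhaseEq A B) (M : Matrix l m ℂ) : PhaseEq (M * A) (M * B) := by
  obtain ⟨c, hc, rfl⟩ := h
  exact ⟨c, hc, Matrix.mul_smul M c B⟩

theorem mul_right [Fintype n] (h : PhaseEq A B) (M : Matrix n l ℂ) : PhaseEq (A * M) (B * M) := by
  obtain ⟨c, hc, rfl⟩ := h
  exact ⟨c, hc, Matrix.smul_mul c B M⟩

theorem conj_eq [Fintype n] (h : PhaseEq A B) (ρ : Matrix n n ℂ) : A * ρ * Aᴴ = B * ρ * Bᴴ := by
  obtain ⟨c, hc, rfl⟩ := h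
  have hcc : c * star c = 1 := by simp [Complex.mul_conj', hc]
  rw [conjTranspose_smul, Matrix.smul_mul, Matrix.smul_mul, Matrix.mul_smul, smul_smul, hcc,
    one_smul]

theorem piKronecker {ι : Type*} [Fintype ι] {M N : ι → Matrix m n ℂ}
    (h : ∀ i, PhaseEq (M i) (N i)) : PhaseEq (piKronecker M) (piKronecker N) := by
  choose c hc hM using h
  obtain rfl : M = fun i => c i • N i := funext hM
  exact ⟨∏ i, c i, by simp [norm_prod, hc], piKronecker_smul c N⟩

end PhaseEq

/-- A Pauli error modulo phases, as the exponents of `σ_x` and of `σ_z`. -/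
abbrev PauliBits := ZMod 2 × ZMod 2

/-- The Pauli operator `σ_x ^ a * σ_z ^ c` with exponents `(a, c)`. -/
def pauliOp (e : PauliBits) : QubitOp := pauliX ^ e.1.val * pauliZ ^ e.2.val

/-- The tensor product of the Pauli operators with given exponents. -/
def pauliString {ι : Type*} [Fintype ι] (e : ι → PauliBits) : Matrix (ι → Fin 2) (ι → Fin 2) ℂ :=
  piKronecker fun i => pauliOp (e i)

/-- The exponents of a letter. -/
def Letter.bits : Letter → PauliBits
  | .I => 0
  | .X => (1, 0)
  | .Z => (0, 1)

theorem sum_zmod_two {M : Type*} [AddCommMonoid M] (f : ZMod 2 → M) : ∑ a, f a = f 0 + f 1 :=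
  Fin.sum_univ_two f

theorem zmod_two_eq_zero_or_one (a : ZMod 2) : a = 0 ∨ a = 1 :=
  by decide +revert

theorem pow_val_add {M : Type*} [Monoid M] {n : ℕ} [NeZero n] {x : M} (hx : x ^ n = 1)
    (a c : ZMod n) : x ^ (a + c).val = x ^ a.val * x ^ c.val := by
  rw [ZMod.val_add, ← pow_eq_pow_mod _ hx, pow_add]

theorem pauliX_sq : pauliX ^ 2 = 1 := by simp [sq, pauliX, one_fin_two]

theorem pauliZ_sq : pauliZ ^ 2 = 1 := by simp [sq, pauliZ, one_fin_two]

theorem pauliX_isHermitian : pauliX.IsHermitian := by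
  ext i j
  fin_cases i <;> fin_cases j <;> simp [pauliX]

theorem pauliZ_isHermitian : pauliZ.IsHermitian := by
  ext i j
  fin_cases i <;> fin_cases j <;> simp [pauliZ]

theorem pauliZ_mul_pauliX : pauliZ * pauliX = -(pauliX * pauliZ) := by
  simp [pauliZ, pauliX]

theorem pauliZ_pow_mul_pauliX_pow (c a : ZMod 2) :
    PhaseEq (pauliZ ^ c.val * pauliX ^ a.val) (pauliX ^ a.val * pauliZ ^ c.val) := by
  rcases zmod_two_eq_zero_or_one c with rfl | rfl <;>
    rcases zmod_two_eq_zero_or_one a with rfl | rfl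
  · simpa using PhaseEq.refl _
  · simpa [ZMod.val_one] using PhaseEq.refl _
  · simpa [ZMod.val_one] using PhaseEq.refl _
  · exact ⟨-1, by simp, by simpa [ZMod.val_one] using pauliZ_mul_pauliX⟩

theorem pauliOp_mul (e f : PauliBits) : PhaseEq (pauliOp e * pauliOp f) (pauliOp (e + f)) := by
  have h := ((pauliZ_pow_mul_pauliX_pow e.2 f.1).mul_left (pauliX ^ e.1.val)).mul_right
    (pauliZ ^ f.2.val)
  simpa only [pauliOp, Prod.fst_add, Prod.snd_add, pow_val_add pauliX_sq, pow_val_add pauliZ_sq,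
    Matrix.mul_assoc] using h

theorem pauliOp_conjTranspose_mul_self (e : PauliBits) : (pauliOp e)ᴴ * pauliOp e = 1 := by
  have hX : pauliX ∈ unitaryGroup (Fin 2) ℂ := by
    rw [mem_unitaryGroup_iff, star_eq_conjTranspose, pauliX_isHermitian.eq, ← sq, pauliX_sq]
  have hZ : pauliZ ∈ unitaryGroup (Fin 2) ℂ := by
    rw [mem_unitaryGroup_iff, star_eq_conjTranspose, pauliZ_isHermitian.eq, ← sq, pauliZ_sq]
  exact mem_unitaryGroup_iff'.1 (mul_mem (pow_mem hX _) (pow_mem hZ _))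

theorem pauliOp_bits (a : Letter) : pauliOp a.bits = a.toOp := by
  cases a <;> simp [pauliOp, Letter.bits, Letter.toOp, ZMod.val_one]

section PauliString

variable {ι : Type*} [Fintype ι]

theorem pauliString_zero : pauliString (0 : ι → PauliBits) = 1 := by
  simp [pauliString, pauliOp, piKronecker_one]

variable [DecidableEq ι]

theorem pauliString_mul (e f : ι → PauliBits) :
    PhaseEq (pauliString e * pauliString f) (pauliString (e + f)) := by
  rw [pauliString, pauliString, piKronecker_mul]
  exact PhaseEq.piKronecker fun i => pauliOp_mul (e i) (f i)

theorem pauliString_conjTranspose_mul_self (e : ι → PauliBits) :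
    (pauliString e)ᴴ * pauliString e = 1 :=
  piKronecker_conjTranspose_mul_self fun i => pauliOp_conjTranspose_mul_self (e i)

end PauliString

/-! ### Propagation of errors through the encoders -/

section Propagation

variable {b t : ℕ} {V : Matrix (Fin b → Fin 2) (Fin 2) ℂ} {Lx Lz : XZString (Fin b)}

theorem XZString.toOp_eq_smul_piKronecker {ι : Type} [Fintype ι] (L : XZString ι) :
    L.toOp = L.phase • piKronecker fun i => (L.letter i).toOp :=
  rfl

theorem IsLogical.mul_pow_phaseEq {ι : Type} [Fintype ι] [DecidableEq ι]
    {W : Matrix (ι → Fin 2) (Fin 2) ℂ} {L : XZString ι} {σ : QubitOp} (h : IsLogical W L σ)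
    (a : ZMod 2) :
    PhaseEq (W * σ ^ a.val) (pauliString (fun k => a • (L.letter k).bits) * W) := by
  obtain rfl | rfl := zmod_two_eq_zero_or_one a
  · simpa [← Pi.zero_def, pauliString_zero] using PhaseEq.refl W
  · refine ⟨L.phase, Complex.norm_eq_one_of_pow_eq_one L.phase_pow (by norm_num), ?_⟩
    simp only [pauliString, ZMod.val_one, pow_one, one_smul, pauliOp_bits]
    rw [← Matrix.smul_mul, ← L.toOp_eq_smul_piKronecker, h]

variable (Lx Lz) in
/-- The Pauli exponents on the children of the error that is equivalent to the error `e` on the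
parent. -/
def pushBits (e : PauliBits) (k : Fin b) : PauliBits :=
  e.1 • (Lx.letter k).bits + e.2 • (Lz.letter k).bits

variable (Lx Lz) in
/-- The Pauli exponents on level `t + 1` of the error that is equivalent to the error `e` on
level `t`. -/
def pushString (e : Node b t → PauliBits) (v : Node b (t + 1)) : PauliBits :=
  pushBits Lx Lz (e (Fin.init v)) (v (Fin.last t))

theorem pushString_child (e : Node b t → PauliBits) (u : Node b t) (k : Fin b) :
    pushString Lx Lz e (child u k) = pushBits Lx Lz (e u) k := by
  simp [pushString, child]

theorem encoder_mul_pauliOp (hLx : IsLogical V Lx pauliX) (hLz : IsLogical V Lz pauliZ)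
    (e : PauliBits) : PhaseEq (V * pauliOp e) (pauliString (pushBits Lx Lz e) * V) := by
  set sx := pauliString fun k => e.1 • (Lx.letter k).bits
  set sz := pauliString fun k => e.2 • (Lz.letter k).bits
  have hx : PhaseEq (V * pauliX ^ e.1.val * pauliZ ^ e.2.val) (sx * V * pauliZ ^ e.2.val) :=
    (hLx.mul_pow_phaseEq e.1).mul_right _
  have hz : PhaseEq (sx * (V * pauliZ ^ e.2.val)) (sx * (sz * V)) :=
    (hLz.mul_pow_phaseEq e.2).mul_left sx
  have hxz : PhaseEq (sx * sz * V) (pauliString (pushBits Lx Lz e) * V) :=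
    (pauliString_mul _ _).mul_right V
  simp only [Matrix.mul_assoc] at hx hz hxz
  exact hx.trans (hz.trans hxz)

theorem encoderLayer_mul_pauliString (hLx : IsLogical V Lx pauliX) (hLz : IsLogical V Lz pauliZ)
    (e : Node b t → PauliBits) :
    PhaseEq (encoderLayer V t * pauliString e)
      (pauliString (pushString Lx Lz e) * encoderLayer V t) := by
  choose c hc h using fun u => encoder_mul_pauliOp hLx hLz (e u)
  refine ⟨∏ u, c u, by simp [norm_prod, hc], encoderLayer_mul_piKronecker fun u => ?_⟩
  simp only [h, pushString_child]
  rfl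

end Propagation

/-! ### Noise as a random Pauli error -/

section Noise

theorem tensorMap_eq_sum_of_kraus {ι κ : Type} [Fintype ι] [DecidableEq ι] [Fintype κ]
    {N : QubitOp →ₗ[ℂ] QubitOp} {q : κ → ℂ} {K : κ → QubitOp}
    (hN : ∀ A, N A = ∑ e, q e • (K e * A * (K e)ᴴ)) (ρ : RegOp ι) :
    tensorMap ι N ρ = ∑ e : ι → κ, (∏ i, q (e i)) •
      (piKronecker (fun i => K (e i)) * ρ * (piKronecker fun i => K (e i))ᴴ) := by
  ext y y'
  have hentry : ∀ (x x' : ι → Fin 2) (i : ι), N (single (x i) (x' i) 1) (y i) (y' i) =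
      ∑ e, q e * (K e (y i) (x i) * star (K e (y' i) (x' i))) := fun x x' i => by
    rw [hN, Matrix.sum_apply]
    simp [mul_apply, single_apply, ite_and]
  have hprod : ∀ x x' : ι → Fin 2, ∏ i, ∑ e, q e * (K e (y i) (x i) * star (K e (y' i) (x' i))) =
      ∑ e : ι → κ, (∏ i, q (e i)) * (piKronecker (fun i => K (e i)) y x *
        star (piKronecker (fun i => K (e i)) y' x')) := fun x x' => by
    rw [Finset.prod_univ_sum, Fintype.piFinset_univ]
    simp [Finset.prod_mul_distrib, piKronecker]
  simp only [tensorMap, of_apply, hentry, hprod, Matrix.sum_apply, Matrix.smul_apply, smul_eq_mul,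
    mul_apply, conjTranspose_apply, Finset.sum_mul, Finset.mul_sum]
  rw [Finset.sum_congr rfl fun x _ => Finset.sum_comm, Finset.sum_comm]
  refine Finset.sum_congr rfl fun e _ => ?_
  rw [Finset.sum_comm]
  refine Finset.sum_congr rfl fun x' _ => Finset.sum_congr rfl fun x _ => ?_
  ring

theorem isLinearMap_tensorMap (ι : Type) [Fintype ι] [DecidableEq ι] (N : QubitOp →ₗ[ℂ] QubitOp) :
    IsLinearMap ℂ (tensorMap ι N) where
  map_add ρ σ := by
    ext y y'
    simp [tensorMap, mul_add, Finset.sum_add_distrib]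
  map_smul c ρ := by
    ext y y'
    simp [tensorMap, Finset.mul_sum, mul_left_comm]

theorem isLinearMap_treeChannel {b : ℕ} (N : QubitOp →ₗ[ℂ] QubitOp)
    (V : Matrix (Fin b → Fin 2) (Fin 2) ℂ) (T : ℕ) : IsLinearMap ℂ (treeChannel N V T) := by
  induction T with
  | zero => exact ⟨fun _ _ => rfl, fun _ _ => rfl⟩
  | succ T ih =>
    have hN := isLinearMap_tensorMap (Node b (T + 1)) N
    constructor
    · intro ρ σ
      rw [treeChannel, ih.map_add, Matrix.mul_add, Matrix.add_mul, hN.map_add]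
      rfl
    · intro c ρ
      rw [treeChannel, ih.map_smul, Matrix.mul_smul, Matrix.smul_mul, hN.map_smul]
      rfl

/-- The law of one bit of a random error that occurs with probability `p`. -/
def bitProb (p : ℝ) (a : ZMod 2) : ℝ := if a = 0 then 1 - p else p

/-- The law of the Pauli error on a noisy qubit: the two bits are independent. -/
def errProb (p : ℝ) (e : PauliBits) : ℝ := bitProb p e.1 * bitProb p e.2

theorem flipChannel_apply {P : QubitOp} (hP : P.IsHermitian) (p : ℝ) (A : QubitOp) :
    flipChannel P p A = ∑ a : ZMod 2, (bitProb p a : ℂ) • (P ^ a.val * A * (P ^ a.val)ᴴ) := by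
  simp [flipChannel, sum_zmod_two, bitProb, ZMod.val_one, hP.eq, Matrix.mul_assoc,
    -Complex.coe_smul]

theorem xzNoise_apply (p : ℝ) (A : QubitOp) :
    xzNoise p A = ∑ e, (errProb p e : ℂ) • (pauliOp e * A * (pauliOp e)ᴴ) := by
  simp only [xzNoise, LinearMap.comp_apply, flipChannel_apply pauliX_isHermitian,
    flipChannel_apply pauliZ_isHermitian, Fintype.sum_prod_type, errProb, pauliOp,
    conjTranspose_mul, Matrix.mul_sum, Matrix.sum_mul, Matrix.mul_smul, Matrix.smul_mul,
    Finset.smul_sum, smul_smul, Complex.ofReal_mul, Matrix.mul_assoc]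

variable {b t : ℕ} {V : Matrix (Fin b → Fin 2) (Fin 2) ℂ} {Lx Lz : XZString (Fin b)}

theorem noisy_encoderLayer_conj_pauliString (hLx : IsLogical V Lx pauliX)
    (hLz : IsLogical V Lz pauliZ) (p : ℝ) (e : Node b t → PauliBits) (σ : RegOp (Node b t)) :
    tensorMap (Node b (t + 1)) (xzNoise p)
        (encoderLayer V t * (pauliString e * σ * (pauliString e)ᴴ) * (encoderLayer V t)ᴴ) =
      ∑ e', ((∏ v, errProb p (e' v + pushString Lx Lz e v) : ℝ) : ℂ) •
        (pauliString e' * (encoderLayer V t * σ * (encoderLayer V t)ᴴ) * (pauliString e')ᴴ) := by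
  set W := encoderLayer V t
  set s := pushString Lx Lz e
  have hpush : ∀ n, PhaseEq (pauliString n * (W * pauliString e)) (pauliString (n + s) * W) :=
    fun n => by
      have hn := (pauliString_mul n s).mul_right W
      rw [Matrix.mul_assoc] at hn
      exact ((encoderLayer_mul_pauliString hLx hLz e).mul_left (pauliString n)).trans hn
  have hconj : ∀ n, pauliString n * (W * (pauliString e * σ * (pauliString e)ᴴ) * Wᴴ) *
      (pauliString n)ᴴ = pauliString (n + s) * (W * σ * Wᴴ) * (pauliString (n + s))ᴴ := fun n => by
    simpa only [conjTranspose_mul, Matrix.mul_assoc] using (hpush n).conj_eq σ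
  have hcancel : ∀ e' : Node b (t + 1) → PauliBits, e' + s + s = e' := fun e' => by
    rw [add_assoc, ZModModule.add_self, add_zero]
  rw [tensorMap_eq_sum_of_kraus (xzNoise_apply p), ← Equiv.sum_comp (Equiv.addRight s)]
  refine Finset.sum_congr rfl fun e' _ => ?_
  have h := hconj (e' + s)
  rw [hcancel] at h
  rw [Complex.ofReal_prod]
  exact congrArg _ h

variable (Lx Lz) in
/-- The law of the Pauli error on level `t` to which the whole noise amounts if it is pushed
through the encoders to that level, given the error at the root. -/
def errKernel (p : ℝ) : (t : ℕ) → PauliBits → (Node b t → PauliBits) → ℝ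
  | 0, e₀, e => if e default = e₀ then 1 else 0
  | t + 1, e₀, e' => ∑ e, errKernel p t e₀ e * ∏ v, errProb p (e' v + pushString Lx Lz e v)

theorem treeChannel_conj_pauliOp (hLx : IsLogical V Lx pauliX) (hLz : IsLogical V Lz pauliZ)
    (p : ℝ) (T : ℕ) (e₀ : PauliBits) (ρ : QubitOp) :
    treeChannel (xzNoise p) V T (pauliOp e₀ * ρ * (pauliOp e₀)ᴴ) =
      ∑ e, (errKernel Lx Lz p T e₀ e : ℂ) •
        (pauliString e * (treeIsometry V T * ρ * (treeIsometry V T)ᴴ) * (pauliString e)ᴴ) := by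
  induction T with
  | zero =>
    have hroot : pauliString (fun _ : Node b 0 => e₀) * treeIsometry V 0 =
        treeIsometry V 0 * pauliOp e₀ := piKronecker_mul_treeIsometry_zero V (pauliOp e₀)
    rw [Fintype.sum_eq_single fun _ => e₀]
    · have h := congrArg (fun A => A * ρ * Aᴴ) hroot
      simp only [conjTranspose_mul, Matrix.mul_assoc] at h
      simp only [treeChannel_zero, errKernel, if_true, Complex.ofReal_one, one_smul,
        Matrix.mul_assoc, h]
    · intro e he
      have hne : e default ≠ e₀ := fun h => he (funext fun u => by rw [← h, Unique.eq_default u])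
      simp [errKernel, hne]
  | succ T ih =>
    have hN : ∀ (c : (Node b T → PauliBits) → ℂ) (A : (Node b T → PauliBits) → RegOp _),
        tensorMap (Node b (T + 1)) (xzNoise p) (∑ e, c e • A e) =
          ∑ e, c e • tensorMap (Node b (T + 1)) (xzNoise p) (A e) := fun c A => by
      have h := map_sum ((isLinearMap_tensorMap (Node b (T + 1)) (xzNoise p)).mk' _)
        (fun e => c e • A e) Finset.univ
      simpa only [map_smul, IsLinearMap.mk'_apply] using h
    have hlayer : treeIsometry V (T + 1) * ρ * (treeIsometry V (T + 1))ᴴ = encoderLayer V T *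
        (treeIsometry V T * ρ * (treeIsometry V T)ᴴ) * (encoderLayer V T)ᴴ := by
      simp only [treeIsometry, conjTranspose_mul, Matrix.mul_assoc]
    rw [treeChannel, ih, hlayer]
    simp only [Matrix.mul_sum, Matrix.sum_mul, Matrix.mul_smul, Matrix.smul_mul, hN,
      noisy_encoderLayer_conj_pauliString hLx hLz, errKernel, Finset.smul_sum, smul_smul,
      Complex.ofReal_sum, Complex.ofReal_mul, Finset.sum_smul]
    exact Finset.sum_comm

end Noise

/-! ### Hellinger distance -/

section Hellinger

variable {Y Y' κ : Type*} [Fintype Y] [Fintype Y'] [Fintype κ] {P R : Y → ℝ}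

/-- The Bhattacharyya coefficient of two distributions. -/
def bhattacharyya (P R : Y → ℝ) : ℝ := ∑ y, √(P y * R y)

/-- The squared Hellinger distance of two distributions, normalised to lie in `[0, 1]`. -/
def hellingerSq (P R : Y → ℝ) : ℝ := 1 - bhattacharyya P R

theorem bhattacharyya_nonneg (P R : Y → ℝ) : 0 ≤ bhattacharyya P R :=
  Finset.sum_nonneg fun _ _ => Real.sqrt_nonneg _

theorem bhattacharyya_le_one (hP : P ∈ stdSimplex ℝ Y) (hR : R ∈ stdSimplex ℝ Y) :
    bhattacharyya P R ≤ 1 := by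
  have h := Real.sum_sqrt_mul_sqrt_le Finset.univ hP.1 hR.1
  simpa only [bhattacharyya, Real.sqrt_mul (hP.1 _), hP.2, hR.2, Real.sqrt_one, mul_one] using h

theorem hellingerSq_self (hP : P ∈ stdSimplex ℝ Y) : hellingerSq P P = 0 := by
  simp only [hellingerSq, bhattacharyya, Real.sqrt_mul_self (hP.1 _), hP.2, sub_self]

theorem hellingerSq_le_one (P R : Y → ℝ) : hellingerSq P R ≤ 1 :=
  sub_le_self 1 (bhattacharyya_nonneg P R)

theorem hellingerSq_comp_equiv (σ : Y' ≃ Y) (P R : Y → ℝ) :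
    hellingerSq (P ∘ σ) (R ∘ σ) = hellingerSq P R :=
  congrArg (1 - ·) (σ.sum_comp fun y => √(P y * R y))

theorem comp_equiv_mem_stdSimplex (σ : Y' ≃ Y) (hP : P ∈ stdSimplex ℝ Y) :
    P ∘ σ ∈ stdSimplex ℝ Y' :=
  ⟨fun y => hP.1 (σ y), (σ.sum_comp P).trans hP.2⟩

theorem one_sub_prod_le_sum {ι : Type*} (s : Finset ι) {x : ι → ℝ} (h0 : ∀ k, 0 ≤ x k)
    (h1 : ∀ k, x k ≤ 1) :
    1 - ∏ k ∈ s, x k ≤ ∑ k ∈ s, (1 - x k) := by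
  classical
  induction s using Finset.induction_on with
  | empty => simp
  | insert a s ha ih =>
    have hs : ∏ k ∈ s, x k ≤ 1 := Finset.prod_le_one (fun k _ => h0 k) fun k _ => h1 k
    rw [Finset.prod_insert ha, Finset.sum_insert ha]
    nlinarith [h0 a, h1 a]

theorem prod_mem_stdSimplex [DecidableEq κ] {P : κ → Y → ℝ} (hP : ∀ k, P k ∈ stdSimplex ℝ Y) :
    (fun y : κ → Y => ∏ k, P k (y k)) ∈ stdSimplex ℝ (κ → Y) := by
  refine ⟨fun y => Finset.prod_nonneg fun k _ => (hP k).1 (y k), ?_⟩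
  rw [← Fintype.piFinset_univ, ← Finset.prod_univ_sum]
  exact Finset.prod_eq_one fun k _ => (hP k).2

theorem bhattacharyya_prod [DecidableEq κ] {P R : κ → Y → ℝ} (hP : ∀ k, 0 ≤ P k)
    (hR : ∀ k, 0 ≤ R k) :
    bhattacharyya (fun y : κ → Y => ∏ k, P k (y k)) (fun y => ∏ k, R k (y k)) =
      ∏ k, bhattacharyya (P k) (R k) := by
  simp only [bhattacharyya]
  rw [Finset.prod_univ_sum, Fintype.piFinset_univ]
  refine Finset.sum_congr rfl fun y _ => ?_
  rw [← Finset.prod_mul_distrib, Real.sqrt_prod _ fun k _ => mul_nonneg (hP k _) (hR k _)]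

theorem hellingerSq_prod_le [DecidableEq κ] {P R : κ → Y → ℝ} (hP : ∀ k, P k ∈ stdSimplex ℝ Y)
    (hR : ∀ k, R k ∈ stdSimplex ℝ Y) :
    hellingerSq (fun y : κ → Y => ∏ k, P k (y k)) (fun y => ∏ k, R k (y k)) ≤
      ∑ k, hellingerSq (P k) (R k) := by
  rw [hellingerSq, bhattacharyya_prod (fun k => (hP k).1) fun k => (hR k).1]
  exact one_sub_prod_le_sum _ (fun k => bhattacharyya_nonneg _ _)
    fun k => bhattacharyya_le_one (hP k) (hR k)

theorem convexOn_hellingerSq :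
    ConvexOn ℝ (Set.Ici 0) fun q : (Y → ℝ) × (Y → ℝ) => hellingerSq q.1 q.2 := by
  refine ⟨convex_Ici 0, fun q hq r hr a b ha hb hab => ?_⟩
  have hpoint : ∀ y, a * √(q.1 y * q.2 y) + b * √(r.1 y * r.2 y) ≤
      √((a * q.1 y + b * r.1 y) * (a * q.2 y + b * r.2 y)) := fun y => by
    rw [Real.sqrt_mul (hq.1 y), Real.sqrt_mul (hr.1 y)]
    refine Real.le_sqrt_of_sq_le ?_
    have hcross := mul_nonneg (mul_nonneg ha hb)
      (sq_nonneg (√(q.1 y) * √(r.2 y) - √(r.1 y) * √(q.2 y)))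
    calc (a * (√(q.1 y) * √(q.2 y)) + b * (√(r.1 y) * √(r.2 y))) ^ 2
        ≤ (a * √(q.1 y) ^ 2 + b * √(r.1 y) ^ 2) * (a * √(q.2 y) ^ 2 + b * √(r.2 y) ^ 2) := by
          linarith
      _ = (a * q.1 y + b * r.1 y) * (a * q.2 y + b * r.2 y) := by
          rw [Real.sq_sqrt (hq.1 y), Real.sq_sqrt (hq.2 y), Real.sq_sqrt (hr.1 y),
            Real.sq_sqrt (hr.2 y)]
  have hsum := Finset.sum_le_sum fun y (_ : y ∈ Finset.univ) => hpoint y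
  rw [Finset.sum_add_distrib, ← Finset.mul_sum, ← Finset.mul_sum] at hsum
  simp only [hellingerSq, bhattacharyya, Prod.fst_add, Prod.smul_fst, Prod.snd_add, Prod.smul_snd,
    Pi.add_apply, Pi.smul_apply, smul_eq_mul]
  linarith

theorem sqrt_flip_mul_flip_ge {p a c : ℝ} (hp0 : 0 ≤ p) (hp1 : p ≤ 1) (ha : 0 ≤ a) (hc : 0 ≤ c) :
    (1 - (1 - 2 * p) ^ 2) * ((a + c) / 2) + (1 - 2 * p) ^ 2 * √(a * c) ≤
      √(((1 - p) * a + p * c) * ((1 - p) * c + p * a)) := by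
  -- With `m` the arithmetic and `s` the geometric mean of `a` and `c`, and `η = (1 - 2 * p) ^ 2`,
  -- the product on the right is `(1 - η) * m ^ 2 + η * s ^ 2`.
  refine Real.le_sqrt_of_sq_le ?_
  have hη : 0 ≤ 1 - (1 - 2 * p) ^ 2 := by nlinarith
  have hsq : ((1 - p) * a + p * c) * ((1 - p) * c + p * a) =
      (1 - (1 - 2 * p) ^ 2) * ((a + c) / 2) ^ 2 + (1 - 2 * p) ^ 2 * √(a * c) ^ 2 := by
    rw [Real.sq_sqrt (mul_nonneg ha hc)]
    ring
  have hconvex := (convexOn_pow 2).2 (x := (a + c) / 2) (y := √(a * c))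
    (Set.mem_Ici.2 (by positivity)) (Set.mem_Ici.2 (by positivity)) hη (sq_nonneg (1 - 2 * p))
    (sub_add_cancel _ _)
  simpa only [hsq, smul_eq_mul] using hconvex

theorem hellingerSq_flip_le {p : ℝ} (hp0 : 0 ≤ p) (hp1 : p ≤ 1) (hP : P ∈ stdSimplex ℝ Y)
    (hR : R ∈ stdSimplex ℝ Y) :
    hellingerSq ((1 - p) • P + p • R) ((1 - p) • R + p • P) ≤
      (1 - 2 * p) ^ 2 * hellingerSq P R := by
  have h := Finset.sum_le_sum fun y (_ : y ∈ Finset.univ) =>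
    sqrt_flip_mul_flip_ge hp0 hp1 (hP.1 y) (hR.1 y)
  rw [Finset.sum_add_distrib, ← Finset.mul_sum, ← Finset.mul_sum, ← Finset.sum_div,
    Finset.sum_add_distrib, hP.2, hR.2] at h
  simp only [hellingerSq, bhattacharyya, Pi.add_apply, Pi.smul_apply, smul_eq_mul]
  linarith

theorem sum_abs_sub_le_sqrt_hellingerSq (hP : P ∈ stdSimplex ℝ Y) (hR : R ∈ stdSimplex ℝ Y) :
    ∑ y, |P y - R y| ≤ 2 * √2 * √(hellingerSq P R) := by
  have hfactor : ∀ y, |P y - R y| = |√(P y) - √(R y)| * (√(P y) + √(R y)) := fun y => by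
    rw [← abs_of_nonneg (a := √(P y) + √(R y)) (by positivity), ← abs_mul, mul_comm, ← sq_sub_sq,
      Real.sq_sqrt (hP.1 y), Real.sq_sqrt (hR.1 y)]
  have hsub : ∑ y, |√(P y) - √(R y)| ^ 2 = 2 * hellingerSq P R := by
    simp only [sq_abs, sub_sq, Real.sq_sqrt (hP.1 _), Real.sq_sqrt (hR.1 _), mul_assoc,
      ← Real.sqrt_mul (hP.1 _), Finset.sum_add_distrib, Finset.sum_sub_distrib, ← Finset.mul_sum,
      hP.2, hR.2, hellingerSq, bhattacharyya]
    ring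
  have hadd : ∑ y, (√(P y) + √(R y)) ^ 2 ≤ 2 ^ 2 := by
    have hle := bhattacharyya_le_one hP hR
    simp only [add_sq, Real.sq_sqrt (hP.1 _), Real.sq_sqrt (hR.1 _), mul_assoc,
      ← Real.sqrt_mul (hP.1 _), Finset.sum_add_distrib, ← Finset.mul_sum, hP.2, hR.2]
    rw [bhattacharyya] at hle
    linarith
  calc ∑ y, |P y - R y|
      ≤ √(∑ y, |√(P y) - √(R y)| ^ 2) * √(∑ y, (√(P y) + √(R y)) ^ 2) := by
        simp only [hfactor]
        exact Real.sum_mul_le_sqrt_mul_sqrt _ _ _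
    _ ≤ √(2 * hellingerSq P R) * 2 := by
        rw [hsub]
        gcongr
        exact Real.sqrt_le_iff.2 ⟨zero_le_two, hadd⟩
    _ = 2 * √2 * √(hellingerSq P R) := by
        rw [Real.sqrt_mul (by norm_num)]
        ring

end Hellinger

/-! ### Observations of random errors -/

section FlipObs

variable {G Y : Type*} [AddCommMonoid G] {p h : ℝ} {W : G → Y → ℝ}

/-- The observation `W` of an error, preceded by the random error that is `u` with probability
`p` and `0` otherwise. An observation is a family of distributions of outcomes that is indexed by
the errors. -/
def flipObs (p : ℝ) (u : G) (W : G → Y → ℝ) (e : G) : Y → ℝ := (1 - p) • W e + p • W (e + u)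

variable [Fintype Y]

theorem flipObs_mem_stdSimplex (hp0 : 0 ≤ p) (hp1 : p ≤ 1) (u : G)
    (hW : ∀ e, W e ∈ stdSimplex ℝ Y) (e : G) : flipObs p u W e ∈ stdSimplex ℝ Y :=
  convex_stdSimplex ℝ Y (hW e) (hW (e + u)) (sub_nonneg.2 hp1) hp0 (sub_add_cancel 1 p)

theorem hellingerSq_flipObs_same_le (hp0 : 0 ≤ p) (hp1 : p ≤ 1) {u : G} (hu : u + u = 0)
    (hW : ∀ e, W e ∈ stdSimplex ℝ Y) (hWu : ∀ e, hellingerSq (W e) (W (e + u)) ≤ h) (e : G) :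
    hellingerSq (flipObs p u W e) (flipObs p u W (e + u)) ≤ (1 - 2 * p) ^ 2 * h := by
  have hflip := hellingerSq_flip_le hp0 hp1 (hW e) (hW (e + u))
  rw [flipObs, flipObs, add_assoc, hu, add_zero]
  exact hflip.trans (mul_le_mul_of_nonneg_left (hWu e) (sq_nonneg _))

theorem hellingerSq_flipObs_le (hp0 : 0 ≤ p) (hp1 : p ≤ 1) {u v : G}
    (hW : ∀ e, W e ∈ stdSimplex ℝ Y) (hWu : ∀ e, hellingerSq (W e) (W (e + u)) ≤ h) (e : G) :
    hellingerSq (flipObs p v W e) (flipObs p v W (e + u)) ≤ h := by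
  have hconvex := convexOn_hellingerSq.2 (x := (W e, W (e + u))) (y := (W (e + v), W (e + v + u)))
    ⟨(hW _).1, (hW _).1⟩ ⟨(hW _).1, (hW _).1⟩ (sub_nonneg.2 hp1) hp0 (sub_add_cancel 1 p)
  rw [flipObs, flipObs, add_right_comm]
  calc _ ≤ (1 - p) * hellingerSq (W e) (W (e + u)) +
        p * hellingerSq (W (e + v)) (W (e + v + u)) := hconvex
    _ ≤ (1 - p) * h + p * h := add_le_add
        (mul_le_mul_of_nonneg_left (hWu e) (sub_nonneg.2 hp1))
        (mul_le_mul_of_nonneg_left (hWu (e + v)) hp0)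
    _ = h := by ring

end FlipObs

section TreeObs

variable {b : ℕ} {Lx Lz : XZString (Fin b)} {p : ℝ} {Y : Type*}

/-- The observation `W` of the error on a qubit, preceded by the noise. -/
def noisyObs (p : ℝ) (W : PauliBits → Y → ℝ) (e : PauliBits) (y : Y) : ℝ :=
  ∑ n, errProb p n * W (e + n) y

variable (Lx Lz) in
/-- The observation of the error on a qubit by the observation `W` of each of its noisy
children. -/
def childObs (p : ℝ) (W : PauliBits → Y → ℝ) (e : PauliBits) (y : Fin b → Y) : ℝ :=
  ∏ k, noisyObs p W (pushBits Lx Lz e k) (y k)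

variable (Lx Lz) in
/-- The observation of the error at the root by the observation `W` of each leaf. -/
def treeObs (p : ℝ) (T : ℕ) (W : PauliBits → Y → ℝ) (e₀ : PauliBits) (y : Node b T → Y) : ℝ :=
  ∑ e, errKernel Lx Lz p T e₀ e * ∏ u, W (e u) (y u)

theorem treeObs_zero (W : PauliBits → Y → ℝ) (e₀ : PauliBits) :
    treeObs Lx Lz p 0 W e₀ = W e₀ ∘ Equiv.funUnique (Node b 0) Y := by
  ext y
  rw [treeObs, Fintype.sum_eq_single fun _ => e₀]
  · simp [errKernel]
  · intro e he
    have hne : e default ≠ e₀ := fun h => he (funext fun u => by rw [← h, Unique.eq_default u])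
    simp [errKernel, hne]

theorem treeObs_succ (T : ℕ) (W : PauliBits → Y → ℝ) (e₀ : PauliBits) :
    treeObs Lx Lz p (T + 1) W e₀ =
      treeObs Lx Lz p T (childObs Lx Lz p W) e₀ ∘ siblingEquiv b T Y := by
  ext y
  have hnoise : ∀ (c : PauliBits) (z : Y),
      ∑ n, errProb p (n + c) * W n z = noisyObs p W c z := fun c z => by
    rw [noisyObs, ← Equiv.sum_comp (Equiv.addRight c)]
    refine Finset.sum_congr rfl fun n _ => ?_
    rw [Equiv.coe_addRight, add_assoc, ZModModule.add_self, add_zero, add_comm]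
  have hleaves (e : Node b T → PauliBits) :
      ∑ e' : Node b (T + 1) → PauliBits, (∏ v, errProb p (e' v + pushString Lx Lz e v)) *
        ∏ v, W (e' v) (y v) = ∏ u, childObs Lx Lz p W (e u) (siblingEquiv b T Y y u) := by
    simp only [← Finset.prod_mul_distrib]
    rw [← Fintype.piFinset_univ, ← Finset.prod_univ_sum
      (fun _ => Finset.univ) fun v n => errProb p (n + pushString Lx Lz e v) * W n (y v)]
    simp only [hnoise, prod_node_succ, pushString_child]
    rfl
  simp only [treeObs, errKernel, Finset.sum_mul, Function.comp_apply, ← hleaves, Finset.mul_sum,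
    mul_assoc]
  exact Finset.sum_comm

theorem errKernel_eq_treeObs (T : ℕ) (e₀ : PauliBits) :
    errKernel Lx Lz p T e₀ = treeObs Lx Lz p T (fun e y => if e = y then 1 else 0) e₀ := by
  ext y
  simp [treeObs, Finset.prod_ite_zero, ← funext_iff]

theorem noisyObs_eq_flipObs (W : PauliBits → Y → ℝ) :
    noisyObs p W = flipObs p (Letter.bits .X) (flipObs p (Letter.bits .Z) W) := by
  ext e y
  have h00 : ((0, 0) : PauliBits) = 0 := rfl
  simp only [noisyObs, flipObs, errProb, bitProb, Fintype.sum_prod_type, sum_zmod_two, Letter.bits,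
    if_true, one_ne_zero, if_false, Pi.add_apply, Pi.smul_apply, smul_eq_mul, add_assoc,
    Prod.mk_add_mk, add_zero, zero_add, h00]
  ring

variable [Fintype Y] {W : PauliBits → Y → ℝ} {h : Letter → ℝ}

theorem noisyObs_mem_stdSimplex (hp0 : 0 ≤ p) (hp1 : p ≤ 1) (hW : ∀ e, W e ∈ stdSimplex ℝ Y)
    (e : PauliBits) : noisyObs p W e ∈ stdSimplex ℝ Y := by
  rw [noisyObs_eq_flipObs]
  exact flipObs_mem_stdSimplex hp0 hp1 _ (flipObs_mem_stdSimplex hp0 hp1 _ hW) e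

theorem hellingerSq_noisyObs_le (hp0 : 0 ≤ p) (hp1 : p ≤ 1) (hW : ∀ e, W e ∈ stdSimplex ℝ Y)
    (hh : ∀ a e, hellingerSq (W e) (W (e + a.bits)) ≤ h a) (a : Letter) (e : PauliBits) :
    hellingerSq (noisyObs p W e) (noisyObs p W (e + a.bits)) ≤ (1 - 2 * p) ^ 2 * h a := by
  have hZW := flipObs_mem_stdSimplex hp0 hp1 (Letter.bits .Z) hW
  have hself : ∀ u : PauliBits, u + u = 0 := ZModModule.add_self
  cases a with
  | I =>
    have h0 : 0 ≤ h .I := by simpa [Letter.bits, hellingerSq_self (hW 0)] using hh .I 0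
    rw [Letter.bits, add_zero, hellingerSq_self (noisyObs_mem_stdSimplex hp0 hp1 hW e)]
    positivity
  | X =>
    rw [noisyObs_eq_flipObs]
    exact hellingerSq_flipObs_same_le hp0 hp1 (hself _) hZW
      (hellingerSq_flipObs_le hp0 hp1 hW (hh .X)) e
  | Z =>
    rw [noisyObs_eq_flipObs]
    exact hellingerSq_flipObs_le hp0 hp1 hZW
      (hellingerSq_flipObs_same_le hp0 hp1 (hself _) hW (hh .Z)) e

theorem childObs_mem_stdSimplex (hp0 : 0 ≤ p) (hp1 : p ≤ 1) (hW : ∀ e, W e ∈ stdSimplex ℝ Y)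
    (e : PauliBits) : childObs Lx Lz p W e ∈ stdSimplex ℝ (Fin b → Y) :=
  prod_mem_stdSimplex fun k => noisyObs_mem_stdSimplex hp0 hp1 hW (pushBits Lx Lz e k)

theorem pushBits_add_bits (e : PauliBits) (a : Letter) (k : Fin b) :
    pushBits Lx Lz (e + a.bits) k = pushBits Lx Lz e k + ((substitute Lx Lz a).letter k).bits := by
  cases a <;> simp [pushBits, Letter.bits, substitute, add_smul] <;> abel

theorem hellingerSq_childObs_le (hp0 : 0 ≤ p) (hp1 : p ≤ 1) (hW : ∀ e, W e ∈ stdSimplex ℝ Y)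
    (hh : ∀ a e, hellingerSq (W e) (W (e + a.bits)) ≤ h a) (a : Letter) (e : PauliBits) :
    hellingerSq (childObs Lx Lz p W e) (childObs Lx Lz p W (e + a.bits)) ≤
      (1 - 2 * p) ^ 2 * ∑ k, h ((substitute Lx Lz a).letter k) := by
  rw [Finset.mul_sum]
  refine (hellingerSq_prod_le (fun k => noisyObs_mem_stdSimplex hp0 hp1 hW _)
    fun k => noisyObs_mem_stdSimplex hp0 hp1 hW _).trans (Finset.sum_le_sum fun k _ => ?_)
  rw [pushBits_add_bits]
  exact hellingerSq_noisyObs_le hp0 hp1 hW hh _ _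

theorem concatLogical_letter_child (a : Letter) {t : ℕ} (u : Node b t) (k : Fin b) :
    (concatLogical Lx Lz a (t + 1)).letter (child u k) =
      (substitute Lx Lz ((concatLogical Lx Lz a t).letter u)).letter k := by
  simp [concatLogical, child]

theorem treeObs_mem_stdSimplex (hp0 : 0 ≤ p) (hp1 : p ≤ 1) (T : ℕ)
    (hW : ∀ e, W e ∈ stdSimplex ℝ Y) (e : PauliBits) :
    treeObs Lx Lz p T W e ∈ stdSimplex ℝ (Node b T → Y) := by
  induction T generalizing Y with
  | zero =>
    rw [treeObs_zero]
    exact comp_equiv_mem_stdSimplex _ (hW e)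
  | succ T ih =>
    rw [treeObs_succ]
    exact comp_equiv_mem_stdSimplex _ (ih (childObs_mem_stdSimplex hp0 hp1 hW))

theorem hellingerSq_treeObs_le (hp0 : 0 ≤ p) (hp1 : p ≤ 1) (T : ℕ)
    (hW : ∀ e, W e ∈ stdSimplex ℝ Y) (hh : ∀ a e, hellingerSq (W e) (W (e + a.bits)) ≤ h a)
    (a : Letter) (e : PauliBits) :
    hellingerSq (treeObs Lx Lz p T W e) (treeObs Lx Lz p T W (e + a.bits)) ≤
      ((1 - 2 * p) ^ 2) ^ T * ∑ u, h ((concatLogical Lx Lz a T).letter u) := by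
  induction T generalizing Y h with
  | zero =>
    rw [treeObs_zero, treeObs_zero, hellingerSq_comp_equiv]
    simpa [concatLogical] using hh a e
  | succ T ih =>
    rw [treeObs_succ, treeObs_succ, hellingerSq_comp_equiv]
    refine (ih (childObs_mem_stdSimplex hp0 hp1 hW)
      (hellingerSq_childObs_le hp0 hp1 hW hh)).trans_eq ?_
    simp only [sum_node_succ, concatLogical_letter_child, ← Finset.mul_sum]
    rw [pow_succ _ T, mul_assoc]

theorem sum_abs_errKernel_sub_le (hp0 : 0 ≤ p) (hp1 : p ≤ 1) (T : ℕ) (a : Letter) (e : PauliBits) :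
    ∑ s, |errKernel Lx Lz p T e s - errKernel Lx Lz p T (e + a.bits) s| ≤
      2 * √2 * √((concatLogical Lx Lz a T).weight) * |1 - 2 * p| ^ T := by
  set W : PauliBits → PauliBits → ℝ := fun e s => if e = s then 1 else 0
  have hW : ∀ e, W e ∈ stdSimplex ℝ PauliBits := ite_eq_mem_stdSimplex ℝ
  have hh : ∀ (a : Letter) e, hellingerSq (W e) (W (e + a.bits)) ≤ if a ≠ .I then 1 else 0 :=
      fun a e => by
    cases a
    · simp [Letter.bits, hellingerSq_self (hW e)]
    all_goals exact hellingerSq_le_one _ _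
  have htree := hellingerSq_treeObs_le (Lx := Lx) (Lz := Lz) hp0 hp1 T hW hh a e
  rw [Finset.sum_boole, ← XZString.weight] at htree
  calc _ ≤ 2 * √2 * √(hellingerSq (treeObs Lx Lz p T W e) (treeObs Lx Lz p T W (e + a.bits))) := by
        simp only [errKernel_eq_treeObs]
        exact sum_abs_sub_le_sqrt_hellingerSq (treeObs_mem_stdSimplex hp0 hp1 T hW _)
          (treeObs_mem_stdSimplex hp0 hp1 T hW _)
    _ ≤ 2 * √2 * √(((1 - 2 * p) ^ 2) ^ T * (concatLogical Lx Lz a T).weight) := by gcongr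
    _ = 2 * √2 * √((concatLogical Lx Lz a T).weight) * |1 - 2 * p| ^ T := by
        rw [Real.sqrt_mul (by positivity), pow_right_comm, Real.sqrt_sq_eq_abs, abs_pow]
        ring

end TreeObs

/-! ### Weights of the concatenated logical operators -/

section Weights

namespace XZString

variable {ι : Type} [Fintype ι]

/-- The vector of the numbers of letters `X` and `Z`, on which the weight transition matrix acts. -/
def countVec (L : XZString ι) : Fin 2 → ℕ := ![L.count .X, L.count .Z]

theorem sum_letter (L : XZString ι) {f : Letter → ℕ} (hf : f .I = 0) :
    ∑ i, f (L.letter i) = f .X * L.count .X + f .Z * L.count .Z := by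
  have hletter : ∀ c, f c = f .X * (if c = .X then 1 else 0) + f .Z * (if c = .Z then 1 else 0) :=
      fun c => by
    cases c <;> simp [hf]
  simp only [hletter (L.letter _), Finset.sum_add_distrib, ← Finset.mul_sum, count,
    Finset.card_filter]

theorem weight_eq_count_add_count (L : XZString ι) : L.weight = L.count .X + L.count .Z := by
  simpa [weight, Finset.card_filter] using L.sum_letter (f := fun c => if c ≠ .I then 1 else 0) rfl

theorem weight_eq_dotProduct_countVec (L : XZString ι) : L.weight = ![1, 1] ⬝ᵥ L.countVec := by
  simp [weight_eq_count_add_count, countVec]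

end XZString

variable {b : ℕ} (Lx Lz : XZString (Fin b))

theorem count_concatLogical_succ (w : Letter) (t : ℕ) {a : Letter} (ha : a ≠ .I) :
    (concatLogical Lx Lz w (t + 1)).count a =
      Lx.count a * (concatLogical Lx Lz w t).count .X +
        Lz.count a * (concatLogical Lx Lz w t).count .Z := by
  have hI : (substitute Lx Lz .I).count a = 0 := by simp [substitute, XZString.count, ha.symm]
  refine Eq.trans ?_ ((concatLogical Lx Lz w t).sum_letter
    (f := fun c => (substitute Lx Lz c).count a) hI)
  simp only [XZString.count, Finset.card_filter, sum_node_succ, concatLogical_letter_child]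

theorem countVec_concatLogical (w : Letter) (T : ℕ) :
    (concatLogical Lx Lz w T).countVec =
      weightMatrix Lx Lz ^ T *ᵥ (concatLogical Lx Lz w 0).countVec := by
  induction T with
  | zero => rw [pow_zero, one_mulVec]
  | succ T ih =>
    rw [pow_succ', ← mulVec_mulVec, ← ih]
    ext i
    fin_cases i <;>
      simp [XZString.countVec, weightMatrix, count_concatLogical_succ, mulVec, dotProduct]

theorem gxz_eq_max_weight (T : ℕ) :
    gxz Lx Lz T = max (concatLogical Lx Lz .X T).weight (concatLogical Lx Lz .Z T).weight := by
  simp only [XZString.weight_eq_dotProduct_countVec, countVec_concatLogical _ _ _ T]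
  simp [gxz, concatLogical, XZString.countVec, XZString.count]

theorem weight_concatLogical_le_bMax_pow (w : Letter) (T : ℕ) :
    (concatLogical Lx Lz w T).weight ≤ bMax Lx Lz ^ T := by
  induction T with
  | zero => exact (Finset.card_filter_le _ _).trans (by simp)
  | succ T ih =>
    set L := concatLogical Lx Lz w T
    calc (concatLogical Lx Lz w (T + 1)).weight
        = Lx.weight * L.count .X + Lz.weight * L.count .Z := by
          simp only [XZString.weight_eq_count_add_count, ne_eq, reduceCtorEq, not_false_eq_true,
            count_concatLogical_succ, L]
          ring
      _ ≤ bMax Lx Lz * L.count .X + bMax Lx Lz * L.count .Z := by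
          gcongr
          exacts [le_max_left _ _, le_max_right _ _]
      _ = L.weight * bMax Lx Lz := by rw [XZString.weight_eq_count_add_count]; ring
      _ ≤ bMax Lx Lz ^ (T + 1) := Nat.mul_le_mul_right _ ih

theorem gxz_le_bMax_pow (T : ℕ) : gxz Lx Lz T ≤ bMax Lx Lz ^ T := by
  rw [gxz_eq_max_weight]
  exact max_le (weight_concatLogical_le_bMax_pow Lx Lz .X T)
    (weight_concatLogical_le_bMax_pow Lx Lz .Z T)

end Weights

section Logical

variable {b : ℕ} {Lx Lz : XZString (Fin b)} {V : Matrix (Fin b → Fin 2) (Fin 2) ℂ}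

theorem isLogical_substitute (hLx : IsLogical V Lx pauliX) (hLz : IsLogical V Lz pauliZ)
    (a : Letter) : IsLogical V (substitute Lx Lz a) a.toOp := by
  cases a with
  | I =>
    simp only [IsLogical, XZString.toOp_eq_smul_piKronecker, substitute, Letter.toOp,
      piKronecker_one, one_smul, Matrix.one_mul, Matrix.mul_one]
  | X => exact hLx
  | Z => exact hLz

theorem isLogical_concatLogical (hLx : IsLogical V Lx pauliX) (hLz : IsLogical V Lz pauliZ)
    (w : Letter) (T : ℕ) : IsLogical (treeIsometry V T) (concatLogical Lx Lz w T) w.toOp := by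
  induction T with
  | zero =>
    rw [IsLogical, XZString.toOp_eq_smul_piKronecker, ← piKronecker_mul_treeIsometry_zero]
    simp only [concatLogical, one_smul]
  | succ T ih =>
    set L := concatLogical Lx Lz w T
    set L' := concatLogical Lx Lz w (T + 1)
    have hlayer : encoderLayer V T * L.toOp = L'.toOp * encoderLayer V T := by
      have hchildren := encoderLayer_mul_piKronecker (V := V) (t := T)
        (S := fun u => (L.letter u).toOp) (M := fun v => (L'.letter v).toOp)
        (c := fun u => (substitute Lx Lz (L.letter u)).phase) fun u => by
          simp only [L', concatLogical_letter_child]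
          rw [← isLogical_substitute hLx hLz, XZString.toOp_eq_smul_piKronecker, Matrix.smul_mul]
      rw [XZString.toOp_eq_smul_piKronecker, XZString.toOp_eq_smul_piKronecker, Matrix.mul_smul,
        hchildren, smul_smul, Matrix.smul_mul]
      rfl
    rw [IsLogical, treeIsometry, ← Matrix.mul_assoc, ← hlayer, Matrix.mul_assoc, ih,
      Matrix.mul_assoc]

end Logical

/-! ### Trace distance of the outputs -/

section TraceDistance

theorem flipChannel_toOp_apply (a : Letter) (p : ℝ) (A : QubitOp) :
    flipChannel a.toOp p A =
      (1 - p : ℂ) • A + (p : ℂ) • (pauliOp a.bits * A * (pauliOp a.bits)ᴴ) := by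
  have hHermitian : a.toOp.IsHermitian := by
    cases a
    exacts [isHermitian_one, pauliX_isHermitian, pauliZ_isHermitian]
  rw [pauliOp_bits, hHermitian.eq, Matrix.mul_assoc]
  rfl

theorem IsDensity.flipChannel_toOp {ρ : QubitOp} (hρ : IsDensity ρ) {p : ℝ} (hp0 : 0 ≤ p)
    (hp1 : p ≤ 1) (a : Letter) : IsDensity (flipChannel a.toOp p ρ) := by
  have hPauli := hρ.conj (pauliOp_conjTranspose_mul_self a.bits)
  have hp : (0 : ℂ) ≤ p := Complex.zero_le_real.2 hp0
  have hp' : (0 : ℂ) ≤ 1 - p := by exact_mod_cast sub_nonneg.2 hp1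
  rw [flipChannel_toOp_apply]
  refine ⟨(hρ.1.smul hp').add (hPauli.1.smul hp), ?_⟩
  rw [trace_add, trace_smul, trace_smul, hρ.2, hPauli.2, ← add_smul, sub_add_cancel, one_smul]

theorem xzNoise_half {ρ : QubitOp} (hρ : ρ.trace = 1) : xzNoise (1 / 2) ρ = (1 / 2 : ℂ) • 1 := by
  have hρ11 : ρ 1 1 = 1 - ρ 0 0 := by rw [← hρ, trace_fin_two, add_sub_cancel_left]
  rw [eta_fin_two ρ, hρ11]
  ext i j
  fin_cases i <;> fin_cases j <;> simp [xzNoise, flipChannel, pauliX, pauliZ] <;> ring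

variable {b : ℕ} {Lx Lz : XZString (Fin b)} {V : Matrix (Fin b → Fin 2) (Fin 2) ℂ} {p : ℝ}
  {ρ : QubitOp}

theorem treeChannel_eq_sum (hLx : IsLogical V Lx pauliX) (hLz : IsLogical V Lz pauliZ) (p : ℝ)
    (T : ℕ) (ρ : QubitOp) :
    treeChannel (xzNoise p) V T ρ = ∑ e, (errKernel Lx Lz p T 0 e : ℂ) •
      (pauliString e * (treeIsometry V T * ρ * (treeIsometry V T)ᴴ) * (pauliString e)ᴴ) := by
  simpa [pauliOp] using treeChannel_conj_pauliOp hLx hLz p T 0 ρ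

theorem isHermitian_treeChannel (hLx : IsLogical V Lx pauliX) (hLz : IsLogical V Lz pauliZ) (p : ℝ)
    (T : ℕ) (hρ : ρ.IsHermitian) : (treeChannel (xzNoise p) V T ρ).IsHermitian := by
  rw [treeChannel_eq_sum hLx hLz]
  refine isSelfAdjoint_sum _ fun e _ => IsSelfAdjoint.smul (Complex.conj_ofReal _) ?_
  exact isHermitian_mul_mul_conjTranspose _ (isHermitian_mul_mul_conjTranspose _ hρ)

theorem traceNorm_treeChannel_sub_conj_pauliOp_le (hV : Vᴴ * V = 1) (hLx : IsLogical V Lx pauliX)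
    (hLz : IsLogical V Lz pauliZ) (hp0 : 0 ≤ p) (hp1 : p ≤ 1) (T : ℕ) (hρ : IsDensity ρ)
    (a : Letter) :
    traceNorm (treeChannel (xzNoise p) V T ρ -
        treeChannel (xzNoise p) V T (pauliOp a.bits * ρ * (pauliOp a.bits)ᴴ)) ≤
      2 * √2 * √((concatLogical Lx Lz a T).weight) * |1 - 2 * p| ^ T := by
  have houtput : ∀ e : Node b T → PauliBits, IsDensity
      (pauliString e * (treeIsometry V T * ρ * (treeIsometry V T)ᴴ) * (pauliString e)ᴴ) := fun e =>
    (hρ.conj (treeIsometry_conjTranspose_mul_self hV T)).conj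
      (pauliString_conjTranspose_mul_self e)
  rw [treeChannel_eq_sum hLx hLz, treeChannel_conj_pauliOp hLx hLz, ← Finset.sum_sub_distrib]
  simp only [← sub_smul, ← Complex.ofReal_sub]
  refine (traceNorm_sum_smul_le _ fun e => (houtput e).1.isHermitian).trans ?_
  simpa only [(houtput _).traceNorm_eq_one, mul_one, zero_add] using
    sum_abs_errKernel_sub_le hp0 hp1 T a 0

theorem traceNorm_treeChannel_sub_flipChannel_half_le (hV : Vᴴ * V = 1)
    (hLx : IsLogical V Lx pauliX) (hLz : IsLogical V Lz pauliZ) (hp0 : 0 ≤ p) (hp1 : p ≤ 1) (T : ℕ)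
    (hρ : IsDensity ρ) (a : Letter) :
    traceNorm (treeChannel (xzNoise p) V T ρ -
        treeChannel (xzNoise p) V T (flipChannel a.toOp (1 / 2) ρ)) ≤
      √2 * √((concatLogical Lx Lz a T).weight) * |1 - 2 * p| ^ T := by
  set ρa := pauliOp a.bits * ρ * (pauliOp a.bits)ᴴ
  have hlinear := isLinearMap_treeChannel (xzNoise p) V T
  have hhalf : treeChannel (xzNoise p) V T ρ -
        treeChannel (xzNoise p) V T (flipChannel a.toOp (1 / 2) ρ) =
      ((1 / 2 : ℝ) : ℂ) • (treeChannel (xzNoise p) V T ρ - treeChannel (xzNoise p) V T ρa) := by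
    rw [flipChannel_toOp_apply, ← hlinear.map_sub, ← hlinear.map_sub, ← hlinear.map_smul]
    congr 1
    module
  have hρa : ρa.IsHermitian := isHermitian_mul_mul_conjTranspose _ hρ.1.isHermitian
  calc _ ≤ |1 / 2| *
          traceNorm (treeChannel (xzNoise p) V T ρ - treeChannel (xzNoise p) V T ρa) := by
        rw [hhalf]
        exact traceNorm_smul_le _ ((isHermitian_treeChannel hLx hLz p T hρ.1.isHermitian).sub
          (isHermitian_treeChannel hLx hLz p T hρa))
    _ ≤ 1 / 2 * (2 * √2 * √((concatLogical Lx Lz a T).weight) * |1 - 2 * p| ^ T) := by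
        rw [abs_of_pos one_half_pos]
        gcongr
        exact traceNorm_treeChannel_sub_conj_pauliOp_le hV hLx hLz hp0 hp1 T hρ a
    _ = _ := by ring

theorem isHermitian_half_smul_one : ((1 / 2 : ℂ) • (1 : QubitOp)).IsHermitian :=
  IsSelfAdjoint.smul (by simp [isSelfAdjoint_iff]) isHermitian_one

theorem traceNorm_treeChannel_sub_le (hV : Vᴴ * V = 1) (hLx : IsLogical V Lx pauliX)
    (hLz : IsLogical V Lz pauliZ) (hp0 : 0 ≤ p) (hp1 : p ≤ 1) (T : ℕ) (hρ : IsDensity ρ) :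
    traceNorm (treeChannel (xzNoise p) V T ρ
        - treeChannel (xzNoise p) V T ((1 / 2 : ℂ) • (1 : QubitOp))) ≤
      2 * √2 * √(gxz Lx Lz T : ℝ) * |1 - 2 * p| ^ T := by
  set E := treeChannel (xzNoise p) V T
  set ρz := flipChannel Letter.Z.toOp (1 / 2) ρ
  have hρz : IsDensity ρz := hρ.flipChannel_toOp one_half_pos.le one_half_lt_one.le .Z
  have hρxz : flipChannel Letter.X.toOp (1 / 2) ρz = (1 / 2 : ℂ) • 1 := xzNoise_half hρ.2
  have hz := traceNorm_treeChannel_sub_flipChannel_half_le hV hLx hLz hp0 hp1 T hρ .Z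
  have hx := traceNorm_treeChannel_sub_flipChannel_half_le hV hLx hLz hp0 hp1 T hρz .X
  rw [hρxz] at hx
  have hE : ∀ {σ : QubitOp}, σ.IsHermitian → (E σ).IsHermitian :=
    isHermitian_treeChannel hLx hLz p T
  calc _ ≤ traceNorm (E ρ - E ρz) + traceNorm (E ρz - E ((1 / 2 : ℂ) • 1)) :=
        traceNorm_sub_le (hE hρ.1.isHermitian) (hE hρz.1.isHermitian) (hE isHermitian_half_smul_one)
    _ ≤ √2 * √(gxz Lx Lz T : ℝ) * |1 - 2 * p| ^ T + √2 * √(gxz Lx Lz T : ℝ) * |1 - 2 * p| ^ T := by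
        rw [gxz_eq_max_weight]
        refine add_le_add (hz.trans ?_) (hx.trans ?_) <;> gcongr
        exacts [le_max_right _ _, le_max_left _ _]
    _ = _ := by ring

theorem traceNorm_treeChannel_sub_treeChannel_le (hV : Vᴴ * V = 1) (hLx : IsLogical V Lx pauliX)
    (hLz : IsLogical V Lz pauliZ) (hp0 : 0 ≤ p) (hp1 : p ≤ 1) (T : ℕ) {ρ' : QubitOp}
    (hρ : IsDensity ρ) (hρ' : IsDensity ρ') :
    traceNorm (treeChannel (xzNoise p) V T ρ - treeChannel (xzNoise p) V T ρ') ≤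
      4 * √2 * √(gxz Lx Lz T : ℝ) * |1 - 2 * p| ^ T := by
  set E := treeChannel (xzNoise p) V T
  have hE : ∀ {σ : QubitOp}, σ.IsHermitian → (E σ).IsHermitian :=
    isHermitian_treeChannel hLx hLz p T
  have hρ_bound := traceNorm_treeChannel_sub_le hV hLx hLz hp0 hp1 T hρ
  have hρ'_bound := traceNorm_treeChannel_sub_le hV hLx hLz hp0 hp1 T hρ'
  rw [traceNorm_sub_comm] at hρ'_bound
  have htriangle := traceNorm_sub_le (hE hρ.1.isHermitian) (hE isHermitian_half_smul_one)
    (hE hρ'.1.isHermitian)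
  linarith

end TraceDistance

/-! ### The threshold -/

section Threshold

open Filter Topology

theorem eventually_norm_pow_le_of_spectralRadius_lt {A : Type*} [NormedRing A] [NormedAlgebra ℂ A]
    [CompleteSpace A] {a : A} {r : ℝ} (hr : spectralRadius ℂ a < ENNReal.ofReal r) :
    ∀ᶠ k : ℕ in atTop, ‖a ^ k‖ ≤ r ^ k := by
  have hr0 : 0 < r := ENNReal.ofReal_pos.1 (pos_of_gt hr)
  have hGelfand := (spectrum.pow_norm_pow_one_div_tendsto_nhds_spectralRadius a).eventually_lt_const
    hr
  filter_upwards [hGelfand, eventually_ne_atTop 0] with k hk hk0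
  have hroot : ‖a ^ k‖ ^ (k⁻¹ : ℝ) < r := by
    simpa only [one_div] using (ENNReal.ofReal_lt_ofReal_iff hr0).1 hk
  calc ‖a ^ k‖ = (‖a ^ k‖ ^ (k⁻¹ : ℝ)) ^ k := (Real.rpow_inv_natCast_pow (norm_nonneg _) hk0).symm
    _ ≤ r ^ k := by gcongr

section LinftyOpNorm

attribute [local instance] Matrix.linftyOpNormedRing Matrix.linftyOpNormedAlgebra

theorem norm_apply_le_linftyOpNorm {m : Type*} [Fintype m] [DecidableEq m] (A : Matrix m m ℂ)
    (i j : m) : ‖A i j‖ ≤ ‖A‖ := by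
  rw [← coe_nnnorm, ← coe_nnnorm, NNReal.coe_le_coe, linfty_opNNNorm_def]
  calc ‖A i j‖₊ ≤ ∑ l, ‖A i l‖₊ :=
        Finset.single_le_sum (f := fun l => ‖A i l‖₊) (fun _ _ => zero_le) (Finset.mem_univ j)
    _ ≤ _ := Finset.le_sup (f := fun i => ∑ l, ‖A i l‖₊) (Finset.mem_univ i)

theorem spectralRadius_matrix_ne_top {m : Type*} [Fintype m] [DecidableEq m] (A : Matrix m m ℂ) :
    spectralRadius ℂ A ≠ ⊤ :=
  ne_top_of_le_ne_top (by simp [ENNReal.mul_eq_top])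
    (spectrum.spectralRadius_le_pow_nnnorm_pow_one_div ℂ A 0)

theorem eventually_norm_pow_apply_le_of_spectralRadius_lt {m : Type*} [Fintype m] [DecidableEq m]
    {A : Matrix m m ℂ} {r : ℝ} (hr : spectralRadius ℂ A < ENNReal.ofReal r) :
    ∀ᶠ k : ℕ in atTop, ∀ i j, ‖(A ^ k) i j‖ ≤ r ^ k :=
  (eventually_norm_pow_le_of_spectralRadius_lt hr).mono fun k hk i j =>
    (norm_apply_le_linftyOpNorm (A ^ k) i j).trans hk

end LinftyOpNorm

variable {b : ℕ} (Lx Lz : XZString (Fin b))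

theorem eventually_gxz_le {r : ℝ} (hr : lambdaMax Lx Lz < r) :
    ∀ᶠ T : ℕ in atTop, (gxz Lx Lz T : ℝ) ≤ 2 * r ^ T := by
  have hradius := (ENNReal.lt_ofReal_iff_toReal_lt (spectralRadius_matrix_ne_top _)).2 hr
  filter_upwards [eventually_norm_pow_apply_le_of_spectralRadius_lt hradius] with T hT
  have hentry : ∀ i j, ((weightMatrix Lx Lz ^ T) i j : ℝ) ≤ r ^ T := fun i j => by
    have hpow := Matrix.map_pow (weightMatrix Lx Lz) (Nat.castRingHom ℂ) T
    rw [Nat.coe_castRingHom] at hpow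
    simpa only [← hpow, map_apply, Complex.norm_natCast] using hT i j
  have hcolumn : ∀ j, ((weightMatrix Lx Lz ^ T) 0 j : ℝ) + (weightMatrix Lx Lz ^ T) 1 j ≤
      2 * r ^ T := fun j => by linarith [hentry 0 j, hentry 1 j]
  simpa [gxz, mulVec, dotProduct] using ⟨hcolumn 0, hcolumn 1⟩

theorem tendsto_gxz_mul_pow_of_lambdaMax {μ : ℝ} (hμ0 : 0 ≤ μ) (hμ : μ * lambdaMax Lx Lz < 1) :
    Tendsto (fun T : ℕ => (gxz Lx Lz T : ℝ) * μ ^ T) atTop (𝓝 0) := by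
  have hcontinuous : Tendsto (fun r => μ * r) (𝓝[>] lambdaMax Lx Lz) (𝓝 (μ * lambdaMax Lx Lz)) :=
    (tendsto_id.const_mul μ).mono_left nhdsWithin_le_nhds
  obtain ⟨r, hμr, hr⟩ :=
    ((hcontinuous.eventually_lt_const hμ).and self_mem_nhdsWithin).exists
  have hr0 : 0 ≤ r := ENNReal.toReal_nonneg.trans hr.le
  have hgeometric : Tendsto (fun T : ℕ => 2 * (μ * r) ^ T) atTop (𝓝 0) := by
    simpa using (tendsto_pow_atTop_nhds_zero_of_lt_one (mul_nonneg hμ0 hr0) hμr).const_mul 2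
  refine squeeze_zero' (Eventually.of_forall fun T => by positivity) ?_ hgeometric
  filter_upwards [eventually_gxz_le Lx Lz hr] with T hT
  calc (gxz Lx Lz T : ℝ) * μ ^ T ≤ 2 * r ^ T * μ ^ T := by gcongr
    _ = 2 * (μ * r) ^ T := by rw [mul_pow]; ring

theorem tendsto_gxz_mul_pow_of_bMax {μ : ℝ} (hμ0 : 0 ≤ μ) (hμ : μ * bMax Lx Lz < 1) :
    Tendsto (fun T : ℕ => (gxz Lx Lz T : ℝ) * μ ^ T) atTop (𝓝 0) := by
  refine squeeze_zero (fun T => by positivity) (fun T => ?_)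
    (tendsto_pow_atTop_nhds_zero_of_lt_one (by positivity) hμ)
  rw [mul_pow, mul_comm]
  gcongr
  exact_mod_cast gxz_le_bMax_pow Lx Lz T

variable {Lx Lz} {V : Matrix (Fin b → Fin 2) (Fin 2) ℂ}

theorem outputBecomesIndependent_of_tendsto (hV : Vᴴ * V = 1) (hLx : IsLogical V Lx pauliX)
    (hLz : IsLogical V Lz pauliZ) {p : ℝ} (hp0 : 0 ≤ p) (hp1 : p ≤ 1)
    (h : Tendsto (fun T : ℕ => (gxz Lx Lz T : ℝ) * ((1 - 2 * p) ^ 2) ^ T) atTop (𝓝 0)) :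
    OutputBecomesIndependent (xzNoise p) V := by
  have hbound : Tendsto (fun T : ℕ => 4 * √2 * √(gxz Lx Lz T : ℝ) * |1 - 2 * p| ^ T) atTop
      (𝓝 0) := by
    convert! h.sqrt.const_mul (4 * √2) using 2 with T
    · rw [Real.sqrt_mul (Nat.cast_nonneg _), pow_right_comm, Real.sqrt_sq_eq_abs, abs_pow]
      ring
    · simp
  intro ε hε
  obtain ⟨T₀, hT₀⟩ := eventually_atTop.1 (hbound.eventually_lt_const hε)
  exact ⟨T₀, fun T hT ρ ρ' hρ hρ' =>
    (traceNorm_treeChannel_sub_treeChannel_le hV hLx hLz hp0 hp1 T hρ hρ').trans_lt (hT₀ T hT)⟩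

end Threshold

/-! ### Anti-standard encoders -/

section AntiStandard

theorem vecMul_antidiagonal_pow {R : Type*} [CommSemiring R] (a c : R) (T : ℕ) :
    ![1, 1] ᵥ* !![0, c; a, 0] ^ T =
      ![a ^ ((T + 1) / 2) * c ^ (T / 2), c ^ ((T + 1) / 2) * a ^ (T / 2)] := by
  induction T with
  | zero => simp
  | succ T ih =>
    have hdiv : (T + 1 + 1) / 2 = T / 2 + 1 := by omega
    rw [pow_succ, ← vecMul_vecMul, ih, hdiv]
    ext i
    fin_cases i <;> simp [vecMul, dotProduct] <;> ring

theorem spectralRadius_antidiagonal (a c : ℂ) :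
    spectralRadius ℂ !![0, c; a, 0] = ENNReal.ofReal √(‖a‖ * ‖c‖) := by
  have hspectrum : ∀ z ∈ spectrum ℂ !![0, c; a, 0], ‖z‖ = √(‖a‖ * ‖c‖) := fun z hz => by
    rw [spectrum.mem_iff, isUnit_iff_isUnit_det, isUnit_iff_ne_zero, not_not, det_fin_two,
      Matrix.algebraMap_eq_diagonal] at hz
    have hz2 : z * z = a * c := by simpa [sub_eq_zero, mul_comm] using hz
    rw [← norm_mul, ← hz2, norm_mul, Real.sqrt_mul_self (norm_nonneg z)]
  calc spectralRadius ℂ !![0, c; a, 0]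
      = ⨆ z ∈ spectrum ℂ !![0, c; a, 0], ENNReal.ofReal √(‖a‖ * ‖c‖) :=
        biSup_congr fun z hz => by rw [← hspectrum z hz, ofReal_norm, enorm_eq_nnnorm]
    _ = _ := biSup_const (spectrum.nonempty_of_isAlgClosed_of_finiteDimensional ℂ _)

theorem XZString.count_eq_zero {ι : Type} [Fintype ι] {L : XZString ι} {a : Letter}
    (h : ∀ k, L.letter k ≠ a) : L.count a = 0 := by
  simp [count, h]

variable {b : ℕ} {Lx Lz : XZString (Fin b)}

theorem weightMatrix_eq_antidiagonal (hx : ∀ k, Lx.letter k ≠ .X) (hz : ∀ k, Lz.letter k ≠ .Z) :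
    weightMatrix Lx Lz = !![0, Lz.weight; Lx.weight, 0] := by
  simp [weightMatrix, XZString.weight_eq_count_add_count, XZString.count_eq_zero hx,
    XZString.count_eq_zero hz]

theorem lambdaMax_of_antiStandard (hx : ∀ k, Lx.letter k ≠ .X) (hz : ∀ k, Lz.letter k ≠ .Z) :
    lambdaMax Lx Lz = √((Lx.weight : ℝ) * (Lz.weight : ℝ)) := by
  have hcast : (weightMatrix Lx Lz).map (Nat.cast : ℕ → ℂ) =
      !![0, (Lz.weight : ℂ); (Lx.weight : ℂ), 0] := by
    ext i j
    fin_cases i <;> fin_cases j <;> simp [weightMatrix_eq_antidiagonal hx hz]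
  rw [lambdaMax, hcast, spectralRadius_antidiagonal, ENNReal.toReal_ofReal (Real.sqrt_nonneg _),
    Complex.norm_natCast, Complex.norm_natCast]

theorem gxz_of_antiStandard (hx : ∀ k, Lx.letter k ≠ .X) (hz : ∀ k, Lz.letter k ≠ .Z) (T : ℕ) :
    gxz Lx Lz T = max (Lx.weight ^ ((T + 1) / 2) * Lz.weight ^ (T / 2))
      (Lz.weight ^ ((T + 1) / 2) * Lx.weight ^ (T / 2)) := by
  simp only [gxz, dotProduct_mulVec, weightMatrix_eq_antidiagonal hx hz, vecMul_antidiagonal_pow]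
  simp

end AntiStandard

end QuantumTree

end

theorem proposition2 (b : ℕ) (V : Matrix (Fin b → Fin 2) (Fin 2) ℂ) (hV : Vᴴ * V = 1)
    (Lx Lz : XZString (Fin b)) (hLx : IsLogical V Lx pauliX) (hLz : IsLogical V Lz pauliZ)
    (p : ℝ) (hp0 : 0 ≤ p) (hp1 : p ≤ 1) :
    -- the bound on the trace distance
    (∀ (T : ℕ) (ρ : QubitOp), IsDensity ρ →
      traceNorm (treeChannel (xzNoise p) V T ρ
          - treeChannel (xzNoise p) V T ((1 / 2 : ℂ) • (1 : QubitOp)))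
        ≤ 2 * √2 * √(gxz Lx Lz T : ℝ) * |1 - 2 * p| ^ T) ∧
    -- the bound on the growth of the weights
    (∀ T : ℕ, gxz Lx Lz T ≤ bMax Lx Lz ^ T) ∧
    -- the concatenated operators are logical operators at level `T`, of weight at most `g(T)`
    (∀ T : ℕ,
      IsLogical (treeIsometry V T) (concatLogical Lx Lz .X T) pauliX ∧
      IsLogical (treeIsometry V T) (concatLogical Lx Lz .Z T) pauliZ ∧
      (concatLogical Lx Lz .X T).weight ≤ gxz Lx Lz T ∧
      (concatLogical Lx Lz .Z T).weight ≤ gxz Lx Lz T) ∧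
    -- the threshold
    ((1 - 2 * p) ^ 2 * min (lambdaMax Lx Lz) (bMax Lx Lz : ℝ) < 1 →
      OutputBecomesIndependent (xzNoise p) V) ∧
    -- anti-standard encoders: `L_x` contains only `σ_z`, and `L_z` contains only `σ_x`
    ((∀ k, Lx.letter k ≠ .X) → (∀ k, Lz.letter k ≠ .Z) →
      lambdaMax Lx Lz = √((Lx.weight : ℝ) * (Lz.weight : ℝ)) ∧
      (∀ T : ℕ, gxz Lx Lz T =
        max (Lx.weight ^ ((T + 1) / 2) * Lz.weight ^ (T / 2))
          (Lz.weight ^ ((T + 1) / 2) * Lx.weight ^ (T / 2))) ∧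
      ((1 - 2 * p) ^ 2 * √((Lx.weight : ℝ) * (Lz.weight : ℝ)) < 1 →
        OutputBecomesIndependent (xzNoise p) V)) := by
  have hbelow_lambdaMax (h : (1 - 2 * p) ^ 2 * lambdaMax Lx Lz < 1) :
      OutputBecomesIndependent (xzNoise p) V :=
    outputBecomesIndependent_of_tendsto hV hLx hLz hp0 hp1
      (tendsto_gxz_mul_pow_of_lambdaMax Lx Lz (sq_nonneg _) h)
  have hbelow_bMax (h : (1 - 2 * p) ^ 2 * bMax Lx Lz < 1) :
      OutputBecomesIndependent (xzNoise p) V :=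
    outputBecomesIndependent_of_tendsto hV hLx hLz hp0 hp1
      (tendsto_gxz_mul_pow_of_bMax Lx Lz (sq_nonneg _) h)
  refine ⟨fun T ρ => traceNorm_treeChannel_sub_le hV hLx hLz hp0 hp1 T, gxz_le_bMax_pow Lx Lz,
    fun T => ⟨isLogical_concatLogical hLx hLz .X T, isLogical_concatLogical hLx hLz .Z T, ?_, ?_⟩,
    fun h => ?_, fun hx hz => ⟨lambdaMax_of_antiStandard hx hz, gxz_of_antiStandard hx hz, ?_⟩⟩
  · exact (le_max_left _ _).trans_eq (gxz_eq_max_weight Lx Lz T).symm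
  · exact (le_max_right _ _).trans_eq (gxz_eq_max_weight Lx Lz T).symm
  · rcases min_choice (lambdaMax Lx Lz) (bMax Lx Lz : ℝ) with hmin | hmin <;> rw [hmin] at h
    exacts [hbelow_lambdaMax h, hbelow_bMax h]
  · exact fun h => hbelow_lambdaMax (by rwa [lambdaMax_of_antiStandard hx hz])
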